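/- Let $1\le n\le 3$, let $\Omega\subset\mathbb R^n$ be a bounded open set with Lipschitz boundary, $f\in L^2(\Omega)$, and put $\mathcal U=H^2(\Omega)\cap H^1_0(\Omega)$. Let $$a(u,v)=\sum_{i,j=1}^n\int_\Omega a_{ij}\,\partial_i u\,\partial_j v\,dx+\sum_{i=1}^n\int_\Omega a_i\,\partial_i u\,v\,dx+\int_\Omega a_0uv\,dx,$$ where $a_{ij},a_i,a_0\in L^\infty(\Omega)$, the $a_{ij}$ are Lipschitz on $\overline\Omega$, $a_0\ge 0$ a.e., $\sum_{i,j}a_{ij}\theta_i\theta_j\ge m|\theta|^2$ a.e. in $\Omega$ for all $\theta\in\mathbb R^n$ with some $m>0$, and $a$ is coercive on $H^1_0(\Omega)$ (that is, $a(u,u)\ge m'\|u\|_{H^1}^2$ for some $m'>0$). Let $A:H^1_0(\Omega)\to H^{-1}(\Omega)$, $\langle Au,v\rangle=a(u,v)$. For $\delta>0$ let $\beta_\delta(r)=\frac1\delta\beta(r)$ with $\beta(r)=0$ for $r\ge0$, $\beta(r)=-r^2$ for $-\frac12\le r\le0$, $\beta(r)=r+\frac14$ for $r\le-\frac12$. For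 $\varphi\in\mathcal U$ let $\mathcal T(\varphi)$ be the unique $y\in H^1_0(\Omega)$ with $y\ge\varphi$ a.e. and $a(y,v-y)\ge\int_\Omega f(v-y)\,dx$ for all $v\in H^1_0(\Omega)$ with $v\ge\varphi$ a.e.; let $\mathcal T^\delta(\varphi)$ be the unique solution $y\in H^1_0(\Omega)$ of $Ay+\beta_\delta(y-\varphi)=f$ in $H^{-1}(\Omega)$; and put $\xi^\delta(\varphi)=\beta_\delta(\mathcal T^\delta(\varphi)-\varphi)$. Then: (i) There is a constant $C$, independent of $\delta$ and $\varphi$, such that $\|\xi^\delta(\varphi)\|_{L^2(\Omega)}\le C\,(1+\|\varphi\|_{H^2(\Omega)})$ for all $\delta>0$ and $\varphi\in\mathcal U$. (ii) Let $\varphi^\delta\in\mathcal U$ ($\delta>0$) converge weakly in $H^2(\Omega)$ to $\varphi^*\in\mathcal U$ as $\delta\to0$, and let $y^*=\mathcal T(\varphi^*)$. Then $\xi^\delta=\xi^\delta(\varphi^\delta)$ is bounded in $L^2(\Omega)$ for small $\delta$ and, as $\delta\to0$, converges weakly in $L^2(\Omega)$ to some $\xi^*\le0$ a.e., and $y^*\in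 H^1_0(\Omega)$ satisfies $Ay^*+\xi^*=f$ in $H^{-1}(\Omega)$. (iii) Suppose that there is a constant $K$ with $\|\varphi\|_{H^2(\Omega)}\le K\|\Delta\varphi\|_{L^2(\Omega)}$ for all $\varphi\in\mathcal U$ (as is the case if $\partial\Omega$ is $C^{1,1}$ or $\Omega$ is convex). Let $z\in L^2(\Omega)$, $\nu>0$, and let $\mathcal U_{ad}\subset\mathcal U$ be convex and closed in $\mathcal U$ for the $H^2$ norm. Let $\varphi^*$ minimize $J(\varphi)=\frac12\|\mathcal T(\varphi)-z\|_{L^2}^2+\frac\nu2\|\Delta\varphi\|_{L^2}^2$ over $\mathcal U_{ad}$ and, for each $\delta>0$, let $\varphi^\delta$ minimize $J_\delta(\varphi)=\frac12\big[\|\mathcal T^\delta(\varphi)-z\|_{L^2}^2+\nu\|\Delta\varphi\|_{L^2}^2+\|\varphi-\varphi^*\|_{L^2}^2\big]$ over $\mathcal U_{ad}$. Then, with $y^\delta=\mathcal T^\delta(\varphi^\delta)$ and $y^*=\mathcal T(\varphi^*)$, the penalty terms $\xi^\delta=\beta_\delta(y^\delta-\varphi^\delta)$ are bounded in $L^2(\Omega)$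 uniformly in $\delta>0$ and, as $\delta\to0$, converge weakly in $L^2(\Omega)$ to some $\xi^*\le0$ a.e., and $Ay^*+\xi^*=f$ in $H^{-1}(\Omega)$. -/

import Mathlib

open MeasureTheory Filter Topology Set
open scoped ContDiff

noncomputable section

namespace ObstacleControl

/-! ### Domains and Sobolev spaces -/

/-- Euclidean space `ℝⁿ`. -/
abbrev E (n : ℕ) : Type := EuclideanSpace ℝ (Fin n)

/-- `Ω` has a Lipschitz boundary: near every boundary point, in suitable orthonormal coordinates
(with `e` the direction of the last axis), `Ω` is the set of points lying strictly above the graph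
of a Lipschitz function of the coordinates orthogonal to `e`. -/
def HasLipschitzBoundary {n : ℕ} (Ω : Set (E n)) : Prop :=
  ∀ x₀ ∈ frontier Ω, ∃ e : E n, ‖e‖ = 1 ∧ ∃ (K : NNReal) (γ : E n → ℝ), LipschitzWith K γ ∧
    ∃ r > 0, ∀ x ∈ Metric.ball x₀ r,
      (x ∈ Ω ↔ γ (x - (inner ℝ e x) • e) < inner ℝ e x)

/-- The Hilbert space `L²(Ω)` of real functions. -/
abbrev L2 {n : ℕ} (Ω : Set (E n)) : Type := Lp ℝ 2 (volume.restrict Ω)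

/-- `ψ` is a test function on `Ω`, that is, `ψ ∈ 𝒟(Ω)`. -/
def IsTestFunction {n : ℕ} (Ω : Set (E n)) (ψ : E n → ℝ) : Prop :=
  ContDiff ℝ ∞ ψ ∧ HasCompactSupport ψ ∧ tsupport ψ ⊆ Ω

/-- `g` is the `i`-th weak partial derivative of `u` in `Ω`. -/
def IsWeakPartial {n : ℕ} {Ω : Set (E n)} (i : Fin n) (u g : L2 Ω) : Prop :=
  ∀ ψ : E n → ℝ, IsTestFunction Ω ψ →
    ∫ x in Ω, u x * fderiv ℝ ψ x (EuclideanSpace.single i 1) = - ∫ x in Ω, g x * ψ x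

open Classical in
/-- The weak partial derivative `∂u/∂xᵢ` if it exists in `L²(Ω)` (it is then unique, for `Ω` open),
and `0` otherwise. It is only used for functions that have one. -/
def pd {n : ℕ} {Ω : Set (E n)} (i : Fin n) (u : L2 Ω) : L2 Ω :=
  if h : ∃ g : L2 Ω, IsWeakPartial i u g then h.choose else 0

/-- `u ∈ H¹(Ω)`. -/
def MemH1 {n : ℕ} {Ω : Set (E n)} (u : L2 Ω) : Prop :=
  ∀ i, ∃ g : L2 Ω, IsWeakPartial i u g

/-- `u ∈ H²(Ω)`. -/
def MemH2 {n : ℕ} {Ω : Set (E n)} (u : L2 Ω) : Prop :=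
  MemH1 u ∧ ∀ i, MemH1 (pd i u)

/-- The norm of `H¹(Ω)`. -/
def normH1 {n : ℕ} {Ω : Set (E n)} (u : L2 Ω) : ℝ :=
  Real.sqrt (‖u‖ ^ 2 + ∑ i, ‖pd i u‖ ^ 2)

/-- The norm of `H²(Ω)`. -/
def normH2 {n : ℕ} {Ω : Set (E n)} (u : L2 Ω) : ℝ :=
  Real.sqrt (‖u‖ ^ 2 + ∑ i, ‖pd i u‖ ^ 2 + ∑ i, ∑ j, ‖pd i (pd j u)‖ ^ 2)

/-- `u ∈ H¹₀(Ω)`: `u` is in the closure of `𝒟(Ω)` in `H¹(Ω)`. -/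
def MemH10 {n : ℕ} {Ω : Set (E n)} (u : L2 Ω) : Prop :=
  MemH1 u ∧ ∀ ε > 0, ∃ w : L2 Ω,
    (∃ ψ : E n → ℝ, IsTestFunction Ω ψ ∧ w =ᵐ[volume.restrict Ω] ψ) ∧ normH1 (u - w) < ε

/-- `u ∈ 𝒰 = H²(Ω) ∩ H¹₀(Ω)`. -/
def MemU {n : ℕ} {Ω : Set (E n)} (u : L2 Ω) : Prop := MemH2 u ∧ MemH10 u

/-- The Laplacian `Δu` of `u ∈ H²(Ω)`. -/
def laplacian {n : ℕ} {Ω : Set (E n)} (u : L2 Ω) : L2 Ω := ∑ i, pd i (pd i u)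

/-- Weak convergence in `L²(Ω)` of a family indexed by `δ`, as `δ → 0⁺`. -/
def WeaklyTendsto {n : ℕ} {Ω : Set (E n)} (u : ℝ → L2 Ω) (u₀ : L2 Ω) : Prop :=
  Tendsto (fun δ => toWeakSpace ℝ (L2 Ω) (u δ)) (𝓝[>] (0 : ℝ)) (𝓝 (toWeakSpace ℝ (L2 Ω) u₀))

/-- Weak convergence in `H²(Ω)` as `δ → 0⁺`, for families in `H²(Ω)`: weak convergence in `L²(Ω)` of
the functions and of all their derivatives of order at most two. (The map sending a function to
these derivatives embeds `H²(Ω)` isometrically into a power of `L²(Ω)`, so this is weak convergence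
in the Hilbert space `H²(Ω)`.) -/
def WeaklyTendstoH2 {n : ℕ} {Ω : Set (E n)} (u : ℝ → L2 Ω) (u₀ : L2 Ω) : Prop :=
  WeaklyTendsto u u₀ ∧ (∀ i, WeaklyTendsto (fun δ => pd i (u δ)) (pd i u₀)) ∧
    ∀ i j, WeaklyTendsto (fun δ => pd i (pd j (u δ))) (pd i (pd j u₀))

/-! ### The elliptic operator -/

/-- The coefficients `aᵢⱼ`, `aᵢ`, `a₀` of a second order operator. -/
structure Coeffs (n : ℕ) where
  /-- the coefficients `aᵢⱼ` -/
  a2 : Fin n → Fin n → E n → ℝ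
  /-- the coefficients `aᵢ` -/
  a1 : Fin n → E n → ℝ
  /-- the coefficient `a₀` -/
  a0 : E n → ℝ

/-- The bilinear form
`a(u,v) = ∑ᵢⱼ ∫ aᵢⱼ ∂ᵢu ∂ⱼv + ∑ᵢ ∫ aᵢ ∂ᵢu v + ∫ a₀ u v`. -/
def Coeffs.form {n : ℕ} (c : Coeffs n) {Ω : Set (E n)} (u v : L2 Ω) : ℝ :=
  (∑ i, ∑ j, ∫ x in Ω, c.a2 i j x * pd i u x * pd j v x)
    + (∑ i, ∫ x in Ω, c.a1 i x * pd i u x * v x) + ∫ x in Ω, c.a0 x * u x * v x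

/-- The standing assumptions on the coefficients: they are in `L^∞(Ω)`, the `aᵢⱼ` are Lipschitz on the
closure of `Ω` and uniformly elliptic, and `a₀ ≥ 0`. -/
structure Coeffs.Admissible {n : ℕ} (c : Coeffs n) (Ω : Set (E n)) : Prop where
  a2_bdd : ∀ i j, MemLp (c.a2 i j) ⊤ (volume.restrict Ω)
  a1_bdd : ∀ i, MemLp (c.a1 i) ⊤ (volume.restrict Ω)
  a0_bdd : MemLp c.a0 ⊤ (volume.restrict Ω)
  a2_lip : ∀ i j, ∃ K : NNReal, LipschitzOnWith K (c.a2 i j) (closure Ω)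
  elliptic : ∃ m > 0, ∀ᵐ x ∂(volume.restrict Ω), ∀ θ : Fin n → ℝ,
    m * ∑ i, θ i ^ 2 ≤ ∑ i, ∑ j, c.a2 i j x * θ i * θ j
  a0_nonneg : ∀ᵐ x ∂(volume.restrict Ω), 0 ≤ c.a0 x

/-- The bilinear form is coercive on `H¹₀(Ω)`. -/
def Coeffs.IsCoercive {n : ℕ} (c : Coeffs n) (Ω : Set (E n)) : Prop :=
  ∃ m > 0, ∀ u : L2 Ω, MemH10 u → m * normH1 u ^ 2 ≤ c.form u u

/-! ### The penalization -/

/-- The profile of the penalization: `β_δ = β₁ / δ`. -/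
def betaOne (r : ℝ) : ℝ :=
  if 0 ≤ r then 0 else if -(1 / 2) ≤ r then - r ^ 2 else r + 1 / 4

/-- The penalization function `β_δ`. -/
def beta (δ r : ℝ) : ℝ := (1 / δ) * betaOne r

lemma betaOne_sub (r s : ℝ) (h : r ≤ s) :
    0 ≤ betaOne s - betaOne r ∧ betaOne s - betaOne r ≤ s - r := by
  unfold betaOne
  constructor <;> split_ifs <;> nlinarith

lemma betaOne_lipschitz : LipschitzWith 1 betaOne := by
  refine LipschitzWith.of_dist_le_mul fun r s => ?_
  rw [Real.dist_eq, Real.dist_eq, NNReal.coe_one, one_mul]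
  rcases le_total r s with h | h
  · have := betaOne_sub r s h
    rw [abs_sub_comm, abs_of_nonneg this.1, abs_sub_comm, abs_of_nonneg (by linarith)]
    exact this.2
  · have := betaOne_sub s r h
    rw [abs_of_nonneg this.1, abs_of_nonneg (by linarith)]
    exact this.2

lemma beta_lipschitz (δ : ℝ) : LipschitzWith ‖1 / δ‖₊ (beta δ) := by
  refine LipschitzWith.of_dist_le_mul fun r s => ?_
  have h := betaOne_lipschitz.dist_le_mul r s
  rw [NNReal.coe_one, one_mul] at h
  rw [Real.dist_eq, beta, beta, ← mul_sub, abs_mul, coe_nnnorm, Real.norm_eq_abs]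
  rw [Real.dist_eq] at h
  exact mul_le_mul_of_nonneg_left h (abs_nonneg _)

lemma beta_zero (δ : ℝ) : beta δ 0 = 0 := by simp [beta, betaOne]

/-- The Nemytskii operator of `β_δ`: the function `x ↦ β_δ(u(x))`, an element of `L²(Ω)`. -/
def betaL2 {n : ℕ} {Ω : Set (E n)} (δ : ℝ) (u : L2 Ω) : L2 Ω :=
  (beta_lipschitz δ).compLp (beta_zero δ) u

/-! ### The control-to-state operators and the control problems -/

/-- `Au + g = f` with `u = 0` on the boundary: `u ∈ H¹₀(Ω)` and the equation holds in `H⁻¹(Ω)`, where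
`A : H¹₀(Ω) → H⁻¹(Ω)` is the operator `⟨Au, v⟩ = a(u,v)`. -/
def SolvesDirichlet {n : ℕ} (c : Coeffs n) {Ω : Set (E n)} (u g f : L2 Ω) : Prop :=
  MemH10 u ∧ ∀ v : L2 Ω, MemH10 v →
    c.form u v + ∫ x in Ω, g x * v x = ∫ x in Ω, f x * v x

/-- `v ∈ 𝒦(φ)`. -/
def MemK {n : ℕ} {Ω : Set (E n)} (φ v : L2 Ω) : Prop :=
  MemH10 v ∧ ∀ᵐ x ∂(volume.restrict Ω), φ x ≤ v x

/-- `y` solves the obstacle problem with obstacle `φ`. -/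
def SolvesObstacle {n : ℕ} (c : Coeffs n) {Ω : Set (E n)} (f φ y : L2 Ω) : Prop :=
  MemK φ y ∧ ∀ v : L2 Ω, MemK φ v → ∫ x in Ω, f x * (v - y) x ≤ c.form y (v - y)

/-- `𝒯(φ)`: the (unique) solution of the obstacle problem with obstacle `φ`. -/
def T {n : ℕ} (c : Coeffs n) {Ω : Set (E n)} (f φ : L2 Ω) : L2 Ω :=
  Classical.epsilon fun y => SolvesObstacle c f φ y

/-- `𝒯^δ(φ)`: the (unique) solution of `Ay + β_δ(y - φ) = f`, `y = 0` on the boundary. -/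
def Tpen {n : ℕ} (c : Coeffs n) {Ω : Set (E n)} (f : L2 Ω) (δ : ℝ) (φ : L2 Ω) : L2 Ω :=
  Classical.epsilon fun y => SolvesDirichlet c y (betaL2 δ (y - φ)) f

/-- The penalty term `β_δ(𝒯^δ(φ) - φ)`. -/
def penalty {n : ℕ} (c : Coeffs n) {Ω : Set (E n)} (f : L2 Ω) (δ : ℝ) (φ : L2 Ω) : L2 Ω :=
  betaL2 δ (Tpen c f δ φ - φ)

/-- The cost functional `J` of the control problem. -/
def J {n : ℕ} (c : Coeffs n) {Ω : Set (E n)} (f z : L2 Ω) (ν : ℝ) (φ : L2 Ω) : ℝ :=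
  1 / 2 * ‖T c f φ - z‖ ^ 2 + ν / 2 * ‖laplacian φ‖ ^ 2

/-- The cost functional `J_δ` of the penalized control problem, adapted to `φ*`. -/
def Jpen {n : ℕ} (c : Coeffs n) {Ω : Set (E n)} (f z : L2 Ω) (ν : ℝ) (φstar : L2 Ω)
    (δ : ℝ) (φ : L2 Ω) : ℝ :=
  1 / 2 * (‖Tpen c f δ φ - z‖ ^ 2 + ν * ‖laplacian φ‖ ^ 2 + ‖φ - φstar‖ ^ 2)

/-- `S` is a closed convex subset of `𝒰`, for the norm of `H²(Ω)`. -/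
def IsClosedConvexInU {n : ℕ} {Ω : Set (E n)} (S : Set (L2 Ω)) : Prop :=
  (∀ φ ∈ S, MemU φ) ∧ Convex ℝ S ∧
    ∀ (φ : ℕ → L2 Ω) (φ₀ : L2 Ω), (∀ k, φ k ∈ S) → MemU φ₀ →
      Tendsto (fun k => normH2 (φ k - φ₀)) atTop (𝓝 0) → φ₀ ∈ S

/-- The quadratic functional `φ ↦ ‖Δφ‖²` is coercive on `𝒰` for the norm of `H²(Ω)`. -/
def LaplacianCoerciveOnU {n : ℕ} (Ω : Set (E n)) : Prop :=
  ∃ K : ℝ, ∀ φ : L2 Ω, MemU φ → normH2 φ ≤ K * ‖laplacian φ‖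

/-- As `δ → 0⁺` the penalty terms of the obstacles `φ^δ` converge weakly in `L²(Ω)` to some `ξ* ≤ 0`,
and `Ay* + ξ* = f` in `Ω`, `y* = 0` on the boundary. -/
def PenaltyLimit {n : ℕ} (c : Coeffs n) {Ω : Set (E n)} (f : L2 Ω) (φ : ℝ → L2 Ω)
    (ystar : L2 Ω) : Prop :=
  ∃ ξstar : L2 Ω, WeaklyTendsto (fun δ => penalty c f δ (φ δ)) ξstar ∧
    (∀ᵐ x ∂(volume.restrict Ω), ξstar x ≤ 0) ∧ SolvesDirichlet c ystar ξstar f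

end ObstacleControl

end

/-! Write `w = y - φ` and `ξ = β_δ(w)`. The bound on `ξ` comes from testing the penalized equation
with `ξ` itself: `(ξ,ξ) = (f,ξ) - a(φ,ξ) - a(w,ξ)`. Since `φ ∈ H²` and the `aᵢⱼ` are Lipschitz, a
derivative can be moved off `ξ`, so `a(φ,·)` is bounded for the `L²` norm (`exists_form_le_normH2`).
Since `β_δ` is nondecreasing and vanishes at `0`, only the first order terms of `a(w,β_δ(w))` can be
negative, and they are at least `-C‖w‖_{H¹}‖ξ‖` (`exists_form_comp_ge`). Coercivity bounds
`‖w‖_{H¹}` uniformly in `δ` (`exists_normH1_Tpen_sub_le`), and division by `‖ξ‖` gives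
`exists_norm_penalty_le`. A chain rule in `H¹₀` is avoided: for fixed `δ`, `w` is replaced by test
functions and `β_δ` by smooth nondecreasing functions.

The limit is taken in `tendsto_Tpen`. A bound on `ξ` forces the negative part of `w` to zero in
`L²`. Subtracting two penalized equations and using the sign of `ξ`, coercivity then shows that the
states form a Cauchy family in `H¹`; no subsequence is needed. The equation determines the limit of
`(ξ,v)` for every `v ∈ H¹₀`, and density with boundedness gives weak convergence of the whole family
`ξ`. The sign conditions survive the limit and say that the limit state solves the obstacle problem.

What this needs is strong `L²` convergence of the obstacles. Weak `H²` convergence provides it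
through `rellich`, proved by the Fourier transform. For optimal obstacles, comparison with `φ*`
bounds the minimizers in `H²`; any weak limit point `v` satisfies `J(v) + ½‖v - φ*‖² ≤ J(φ*) ≤
J(v)`, hence `v = φ*` (`tendsto_minimizers`). -/

noncomputable section

namespace ObstacleControl

/-! ### Hilbert space preliminaries -/

section Hilbert

variable {H : Type*} [NormedAddCommGroup H] [InnerProductSpace ℝ H]

/-- Zarantonello's theorem: a strongly monotone Lipschitz operator on a Hilbert space has a zero. -/
lemma exists_zero_of_strongly_monotone [CompleteSpace H] (N : H → H) {m L : ℝ} (hm : 0 < m)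
    (hmono : ∀ u v, m * ‖u - v‖ ^ 2 ≤ inner ℝ (N u - N v) (u - v))
    (hlip : ∀ u v, ‖N u - N v‖ ≤ L * ‖u - v‖) : ∃ u, N u = 0 := by
  -- `M` dominates `L` and exceeds `m` whatever the sign of `L`. The step `t = m / M ^ 2` minimizes
  -- `1 - 2tm + t²M²`, with minimum `q`, so `u ↦ u - t • N u` contracts by `√q`.
  set M : ℝ := max L m + m with hM
  have hmM : m < M := by have := le_max_right L m; linarith
  have hLM : L ≤ M := by have := le_max_left L m; linarith
  have hM0 : 0 < M := hm.trans hmM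
  set t : ℝ := m / M ^ 2 with ht
  have ht0 : 0 < t := by positivity
  set q : ℝ := 1 - m ^ 2 / M ^ 2 with hq
  have hq0 : 0 ≤ q := by
    rw [hq, sub_nonneg, div_le_one (by positivity)]
    gcongr
  have hq1 : q < 1 := by
    rw [hq]; have : 0 < m ^ 2 / M ^ 2 := by positivity
    linarith
  have key : ∀ u v, ‖(u - t • N u) - (v - t • N v)‖ ≤ Real.sqrt q * ‖u - v‖ := by
    intro u v
    have e : (u - t • N u) - (v - t • N v) = (u - v) - t • (N u - N v) := by
      rw [smul_sub]; abel
    have h1 : ‖(u - v) - t • (N u - N v)‖ ^ 2 ≤ q * ‖u - v‖ ^ 2 := by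
      rw [norm_sub_sq_real, inner_smul_right, norm_smul, Real.norm_of_nonneg ht0.le, real_inner_comm]
      have h2 := hmono u v
      have h3 : ‖N u - N v‖ ^ 2 ≤ M ^ 2 * ‖u - v‖ ^ 2 := by
        rw [← mul_pow]
        exact pow_le_pow_left₀ (norm_nonneg _)
          ((hlip u v).trans (mul_le_mul_of_nonneg_right hLM (norm_nonneg _))) 2
      have h4 : t * (m * ‖u - v‖ ^ 2) ≤ t * inner ℝ (N u - N v) (u - v) := by gcongr
      have h5 : t ^ 2 * ‖N u - N v‖ ^ 2 ≤ t ^ 2 * (M ^ 2 * ‖u - v‖ ^ 2) := by gcongr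
      have h6 : t * m = m ^ 2 / M ^ 2 := by rw [ht]; ring
      have h7 : t ^ 2 * M ^ 2 = m ^ 2 / M ^ 2 := by rw [ht]; field_simp
      have h8 : t ^ 2 * (M ^ 2 * ‖u - v‖ ^ 2) = m ^ 2 / M ^ 2 * ‖u - v‖ ^ 2 := by
        rw [← mul_assoc, h7]
      have h9 : t * (m * ‖u - v‖ ^ 2) = m ^ 2 / M ^ 2 * ‖u - v‖ ^ 2 := by
        rw [← mul_assoc, h6]
      rw [hq, mul_pow]
      linarith
    rw [e]
    refine abs_le_of_sq_le_sq' ?_ (by positivity) |>.2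
    rw [mul_pow, Real.sq_sqrt hq0]
    exact h1
  have hc : ContractingWith (Real.sqrt q).toNNReal fun u => u - t • N u := by
    refine ⟨?_, LipschitzWith.of_dist_le_mul fun u v => ?_⟩
    · rw [Real.toNNReal_lt_one, Real.sqrt_lt' one_pos]
      simpa using hq1
    · rw [dist_eq_norm, dist_eq_norm, Real.coe_toNNReal _ (Real.sqrt_nonneg _)]
      exact key u v
  refine ⟨hc.fixedPoint, ?_⟩
  have h : hc.fixedPoint - t • N hc.fixedPoint = hc.fixedPoint := hc.fixedPoint_isFixedPt
  rw [sub_eq_self, smul_eq_zero] at h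
  exact h.resolve_left ht0.ne'

/-- Bounded sequences in a separable Hilbert space have weakly convergent subsequences. -/
lemma exists_weakly_convergent_subseq [CompleteSpace H] [TopologicalSpace.SeparableSpace H]
    (u : ℕ → H) {C : ℝ} (hu : ∀ k, ‖u k‖ ≤ C) :
    ∃ (v : H) (s : ℕ → ℕ), StrictMono s ∧
      ∀ w : H, Tendsto (fun k => inner ℝ (u (s k)) w) atTop (𝓝 (inner ℝ v w)) := by
  have hmem : ∀ k, (StrongDual.toWeakDual (InnerProductSpace.toDual ℝ H (u k)))
      ∈ WeakDual.toStrongDual ⁻¹' Metric.closedBall (0 : StrongDual ℝ H) C := by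
    intro k
    simpa using hu k
  obtain ⟨F, -, s, hs, hF⟩ := WeakDual.isSeqCompact_closedBall ℝ H 0 C hmem
  refine ⟨(InnerProductSpace.toDual ℝ H).symm (WeakDual.toStrongDual F), s, hs, fun w => ?_⟩
  have := (WeakDual.eval_continuous w).tendsto F |>.comp hF
  simpa [Function.comp_def] using this

/-- A closed convex set of a Hilbert space is weakly sequentially closed. -/
lemma mem_of_weakly_tendsto [CompleteSpace H] {S : Set H} (hS : IsClosed S) (hconv : Convex ℝ S)
    (u : ℕ → H) (hu : ∀ k, u k ∈ S) (v : H)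
    (hv : ∀ w : H, Tendsto (fun k => inner ℝ (u k) w) atTop (𝓝 (inner ℝ v w))) : v ∈ S := by
  obtain ⟨p, hp, hmin⟩ :=
    exists_norm_eq_iInf_of_complete_convex ⟨u 0, hu 0⟩ hS.isComplete hconv v
  rw [norm_eq_iInf_iff_real_inner_le_zero hconv hp] at hmin
  have h1 : Tendsto (fun k => inner ℝ (u k) (v - p) - inner ℝ p (v - p)) atTop
      (𝓝 (inner ℝ v (v - p) - inner ℝ p (v - p))) := (hv (v - p)).sub_const _
  have h2 : inner ℝ v (v - p) - inner ℝ p (v - p) ≤ 0 := by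
    refine le_of_tendsto' h1 fun k => ?_
    rw [← inner_sub_left, real_inner_comm]
    exact hmin _ (hu k)
  rw [← inner_sub_left, real_inner_self_nonpos, sub_eq_zero] at h2
  rwa [h2]

/-- A family converging weakly along a countably generated filter is eventually bounded. -/
lemma eventually_norm_le_of_weakly_tendsto [CompleteSpace H] {ι : Type*} {l : Filter ι}
    [l.IsCountablyGenerated] (u : ι → H) (v : H)
    (h : ∀ w : H, Tendsto (fun i => inner ℝ (u i) w) l (𝓝 (inner ℝ v w))) :
    ∃ C : ℝ, ∀ᶠ i in l, ‖u i‖ ≤ C := by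
  -- Otherwise a countable basis of `l` yields a sequence tending to `l` along which the norms
  -- exceed `k`, against the uniform boundedness principle.
  by_contra! hcon
  obtain ⟨B, hB⟩ := l.exists_antitone_basis
  have hex : ∀ k : ℕ, ∃ i, i ∈ B k ∧ (k : ℝ) < ‖u i‖ := by
    intro k
    obtain ⟨i, hi⟩ := ((hcon k).and_eventually (hB.1.mem_of_mem (i := k) trivial)).exists
    exact ⟨i, hi.2, hi.1⟩
  choose s hsB hs using hex
  have hsl : Tendsto s atTop l := hB.tendsto hsB
  obtain ⟨C, hC⟩ := banach_steinhaus (g := fun k => innerSL ℝ (u (s k))) (fun w => by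
    obtain ⟨C, hC⟩ := ((h w).comp hsl).norm.bddAbove_range
    exact ⟨C, fun k => hC ⟨k, rfl⟩⟩)
  obtain ⟨k, hk⟩ := exists_nat_gt C
  have := hC k
  rw [innerSL_apply_norm] at this
  linarith [hs k]

/-- A bounded family whose inner products with the elements of a dense set converge is weakly
convergent. -/
lemma exists_weak_limit [CompleteSpace H] {ι : Type*} {l : Filter ι} [l.IsCountablyGenerated]
    [l.NeBot] (u : ι → H) {C : ℝ} (hC : ∀ᶠ i in l, ‖u i‖ ≤ C) {D : Set H} (hD : Dense D)
    (h : ∀ w ∈ D, ∃ a : ℝ, Tendsto (fun i => inner ℝ (u i) w) l (𝓝 a)) :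
    ∃ v : H, ∀ w : H, Tendsto (fun i => inner ℝ (u i) w) l (𝓝 (inner ℝ v w)) := by
  have hC0 : 0 ≤ C := by
    obtain ⟨i, hi⟩ := hC.exists
    exact (norm_nonneg _).trans hi
  have hall : ∀ w : H, ∃ a : ℝ, Tendsto (fun i => inner ℝ (u i) w) l (𝓝 a) := by
    intro w
    refine cauchy_map_iff_exists_tendsto.1 (Metric.cauchy_iff.2 ⟨inferInstance, fun ε hε => ?_⟩)
    obtain ⟨w', hw', hd⟩ := Metric.mem_closure_iff.1 (hD w) (ε / (3 * (C + 1))) (by positivity)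
    obtain ⟨a, ha⟩ := h w' hw'
    -- Replacing `w` by a nearby element of `D` costs `ε / 3` uniformly in `i`, so the Cauchy
    -- property passes from `D` to all of `H`.
    have hest : ∀ i, ‖u i‖ ≤ C → |inner ℝ (u i) w - inner ℝ (u i) w'| ≤ ε / 3 := by
      intro i hi
      rw [← inner_sub_right]
      refine (abs_real_inner_le_norm _ _).trans ?_
      rw [dist_eq_norm] at hd
      calc ‖u i‖ * ‖w - w'‖ ≤ (C + 1) * (ε / (3 * (C + 1))) := by gcongr; linarith
        _ = ε / 3 := by field_simp
    refine ⟨_, image_mem_map (inter_mem hC (Metric.tendsto_nhds.1 ha (ε / 6) (by positivity))), ?_⟩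
    rintro _ ⟨i, ⟨hi, hi'⟩, rfl⟩ _ ⟨j, ⟨hj, hj'⟩, rfl⟩
    have h1 := abs_le.1 (hest i hi)
    have h2 := abs_le.1 (hest j hj)
    simp only [mem_ofPred_eq, Real.dist_eq] at hi' hj'
    rw [abs_lt] at hi' hj'
    rw [Real.dist_eq, abs_lt]
    constructor <;> linarith [h1.1, h1.2, h2.1, h2.2, hi'.1, hi'.2, hj'.1, hj'.2]
  choose a ha using hall
  have hlim : Tendsto (fun i w => innerSL ℝ (u i) w) l (𝓝 a) := by
    rw [tendsto_pi_nhds]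
    exact ha
  let F : StrongDual ℝ H := continuousLinearMapOfTendsto (fun i => innerSL ℝ (u i)) hlim
  refine ⟨(InnerProductSpace.toDual ℝ H).symm F, fun w => ?_⟩
  rw [InnerProductSpace.toDual_symm_apply]
  exact ha w

/-- The inner product of a bounded weakly convergent and a strongly convergent family converges. -/
lemma tendsto_inner_of_weakly_of_strongly {ι : Type*} {l : Filter ι} {u w : ι → H} {v x : H}
    {C : ℝ} (hC : ∀ᶠ i in l, ‖u i‖ ≤ C)
    (hu : ∀ z : H, Tendsto (fun i => inner ℝ (u i) z) l (𝓝 (inner ℝ v z)))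
    (hw : Tendsto w l (𝓝 x)) :
    Tendsto (fun i => inner ℝ (u i) (w i)) l (𝓝 (inner ℝ v x)) := by
  have h1 : Tendsto (fun i => inner ℝ (u i) (w i - x)) l (𝓝 0) := by
    have h2 : Tendsto (fun i => C * ‖w i - x‖) l (𝓝 0) := by
      simpa using (tendsto_iff_norm_sub_tendsto_zero.1 hw).const_mul C
    refine squeeze_zero_norm' ?_ h2
    filter_upwards [hC] with i hi
    exact (abs_real_inner_le_norm _ _).trans (mul_le_mul_of_nonneg_right hi (norm_nonneg _))
  have h3 := (hu x).add h1
  rw [add_zero] at h3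
  refine h3.congr fun i => ?_
  rw [inner_sub_right]; ring

end Hilbert

/-! ### Smoothing of Lipschitz functions -/

/-- Mollification averages translates of `g`, so any one-sided bound on the increments by a fixed
`v` is inherited. This one property yields both the Lipschitz constant (bounds in every direction)
and monotonicity (`c = 0`). -/
lemma exists_smooth_approx {F : Type*} [NormedAddCommGroup F] [InnerProductSpace ℝ F]
    [FiniteDimensional ℝ F] [MeasurableSpace F] [BorelSpace F] {K : NNReal} {g : F → ℝ}
    (hg : LipschitzWith K g) {ε : ℝ} (hε : 0 < ε) :
    ∃ G : F → ℝ, ContDiff ℝ ∞ G ∧ (∀ x, |G x - g x| ≤ ε) ∧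
      ∀ v c, (∀ x, g (x + v) - g x ≤ c) → ∀ x, G (x + v) - G x ≤ c := by
  -- On a ball of this radius `g` varies by at most `K * r ≤ ε`; the `+ 1` covers `K = 0`.
  set r : ℝ := ε / (K + 1) with hr
  have hr0 : 0 < r := by positivity
  let ρ : ContDiffBump (0 : F) := ⟨r / 2, r, by positivity, by linarith⟩
  set G : F → ℝ := convolution (ρ.normed volume) g (ContinuousLinearMap.lsmul ℝ ℝ) volume with hG
  have hint : ∀ x, Integrable fun t => ρ.normed volume t * g (x - t) := by
    intro x
    refine Continuous.integrable_of_hasCompactSupport ?_ ?_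
    · exact ρ.continuous_normed.mul (hg.continuous.comp (by fun_prop))
    · exact (ρ.hasCompactSupport_normed).mul_right
  refine ⟨G, ?_, ?_, ?_⟩
  · exact ρ.hasCompactSupport_normed.contDiff_convolution_left _ ρ.contDiff_normed
      hg.continuous.locallyIntegrable
  · intro x
    rw [← Real.dist_eq]
    refine ρ.dist_normed_convolution_le hg.continuous.aestronglyMeasurable fun y hy => ?_
    refine (hg.dist_le_mul y x).trans ?_
    calc (K : ℝ) * dist y x ≤ (K + 1) * r := by
          have : dist y x < r := hy
          gcongr; linarith
      _ = ε := by rw [hr]; field_simp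
  · intro v c h x
    have e : ∀ y, G y = ∫ t, ρ.normed volume t * g (y - t) := fun y => rfl
    rw [e, e, ← integral_sub (hint _) (hint _)]
    calc ∫ t, (ρ.normed volume t * g (x + v - t) - ρ.normed volume t * g (x - t))
        ≤ ∫ t, ρ.normed volume t * c := by
          refine integral_mono ((hint _).sub (hint _)) (ρ.integrable_normed.mul_const c) fun t => ?_
          simp only
          rw [← mul_sub]
          refine mul_le_mul_of_nonneg_left ?_ (ρ.nonneg_normed t)
          have := h (x - t)
          rwa [show x - t + v = x + v - t by abel] at this
      _ = c := by rw [integral_mul_const, ρ.integral_normed, one_mul]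

variable {n : ℕ} {Ω : Set (E n)}

/-! ### Test functions in `L²` -/

/-- The `i`-th classical partial derivative. -/
def partialDeriv (i : Fin n) (ψ : E n → ℝ) (x : E n) : ℝ :=
  fderiv ℝ ψ x (EuclideanSpace.single i 1)

lemma inner_eq_integral (u v : L2 Ω) : inner ℝ u v = ∫ x in Ω, u x * v x := by
  rw [L2.inner_def]
  refine integral_congr_ae (Eventually.of_forall fun x => ?_)
  simp [mul_comm]

lemma IsTestFunction.partialDeriv {ψ : E n → ℝ} (h : IsTestFunction Ω ψ) (i : Fin n) :
    IsTestFunction Ω (partialDeriv i ψ) := by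
  obtain ⟨h1, h2, h3⟩ := h
  have hs : tsupport (ObstacleControl.partialDeriv i ψ) ⊆ tsupport ψ := by
    refine (closure_mono ?_).trans (tsupport_fderiv_subset ℝ)
    intro x hx hx'
    exact hx (by simp [ObstacleControl.partialDeriv, hx'])
  refine ⟨?_, ?_, hs.trans h3⟩
  · exact (h1.fderiv_right (m := ∞) (by simp)).clm_apply contDiff_const
  · exact h2.of_isClosed_subset (isClosed_tsupport _) hs

lemma IsTestFunction.memLp {ψ : E n → ℝ} (h : IsTestFunction Ω ψ) (p : ENNReal) :
    MemLp ψ p (volume.restrict Ω) :=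
  (h.1.continuous.memLp_of_hasCompactSupport h.2.1).restrict Ω

/-- The element of `L²(Ω)` given by a test function. -/
def IsTestFunction.toL2 {ψ : E n → ℝ} (h : IsTestFunction Ω ψ) : L2 Ω := (h.memLp 2).toLp ψ

lemma IsTestFunction.coeFn_toL2 {ψ : E n → ℝ} (h : IsTestFunction Ω ψ) :
    h.toL2 =ᵐ[volume.restrict Ω] ψ := (h.memLp 2).coeFn_toLp

lemma IsTestFunction.eq_toL2 {ψ : E n → ℝ} (h : IsTestFunction Ω ψ) {w : L2 Ω}
    (hw : w =ᵐ[volume.restrict Ω] ψ) : w = h.toL2 :=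
  Lp.ext (hw.trans h.coeFn_toL2.symm)

lemma IsTestFunction.inner_toL2 {ψ : E n → ℝ} (h : IsTestFunction Ω ψ) (u : L2 Ω) :
    inner ℝ u h.toL2 = ∫ x in Ω, u x * ψ x := by
  rw [inner_eq_integral]
  refine integral_congr_ae ?_
  filter_upwards [h.coeFn_toL2] with x hx
  rw [hx]

lemma IsTestFunction.zero : IsTestFunction Ω (fun _ => 0) := by
  refine ⟨contDiff_const, HasCompactSupport.zero, ?_⟩
  rw [show (fun _ : E n => (0 : ℝ)) = 0 from rfl, tsupport_zero]
  exact empty_subset _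

lemma IsTestFunction.add {ψ χ : E n → ℝ} (h : IsTestFunction Ω ψ) (h' : IsTestFunction Ω χ) :
    IsTestFunction Ω (fun x => ψ x + χ x) :=
  ⟨h.1.add h'.1, h.2.1.add h'.2.1, (tsupport_add ψ χ).trans (union_subset h.2.2 h'.2.2)⟩

lemma IsTestFunction.const_mul {ψ : E n → ℝ} (h : IsTestFunction Ω ψ) (c : ℝ) :
    IsTestFunction Ω (fun x => c * ψ x) :=
  ⟨contDiff_const.mul h.1, h.2.1.mul_left, (tsupport_mul_subset_right).trans h.2.2⟩

lemma IsTestFunction.smooth_mul {ψ G : E n → ℝ} (h : IsTestFunction Ω ψ) (hG : ContDiff ℝ ∞ G) :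
    IsTestFunction Ω (fun x => G x * ψ x) :=
  ⟨hG.mul h.1, h.2.1.mul_left, (tsupport_mul_subset_right).trans h.2.2⟩

lemma IsTestFunction.comp {ψ : E n → ℝ} (h : IsTestFunction Ω ψ) {G : ℝ → ℝ}
    (hG : ContDiff ℝ ∞ G) (hG0 : G 0 = 0) : IsTestFunction Ω (fun x => G (ψ x)) := by
  have hs : tsupport (fun x => G (ψ x)) ⊆ tsupport ψ := by
    refine closure_mono fun x hx hx' => hx ?_
    simp only
    rw [hx', hG0]
  exact ⟨hG.comp h.1, h.2.1.of_isClosed_subset (isClosed_tsupport _) hs, hs.trans h.2.2⟩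

/-- The subspace of test functions in `L²(Ω)`. -/
def testSubmodule (Ω : Set (E n)) : Submodule ℝ (L2 Ω) where
  carrier := {w | ∃ (ψ : E n → ℝ) (h : IsTestFunction Ω ψ), w = h.toL2}
  add_mem' := by
    rintro _ _ ⟨ψ, h, rfl⟩ ⟨χ, h', rfl⟩
    refine ⟨_, h.add h', (h.add h').eq_toL2 ?_⟩
    filter_upwards [h.coeFn_toL2, h'.coeFn_toL2, Lp.coeFn_add h.toL2 h'.toL2] with x h1 h2 h3
    rw [h3, Pi.add_apply, h1, h2]
  zero_mem' := ⟨_, IsTestFunction.zero, IsTestFunction.zero.eq_toL2 (Lp.coeFn_zero _ _ _)⟩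
  smul_mem' := by
    rintro c _ ⟨ψ, h, rfl⟩
    refine ⟨_, h.const_mul c, (h.const_mul c).eq_toL2 ?_⟩
    filter_upwards [h.coeFn_toL2, Lp.coeFn_smul c h.toL2] with x h1 h2
    rw [h2, Pi.smul_apply, h1, smul_eq_mul]

lemma eq_zero_of_forall_test (hΩ : IsOpen Ω) {u : L2 Ω}
    (h : ∀ (ψ : E n → ℝ) (hψ : IsTestFunction Ω ψ), inner ℝ u hψ.toL2 = 0) : u = 0 := by
  have h1 : ∀ᵐ x ∂(volume : Measure (E n)), x ∈ Ω → u x = 0 := by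
    refine hΩ.ae_eq_zero_of_integral_contDiff_smul_eq_zero ?_ fun g g1 g2 g3 => ?_
    · exact locallyIntegrableOn_of_locallyIntegrable_restrict
        ((Lp.memLp u).locallyIntegrable (by norm_num))
    · have hg : IsTestFunction Ω g := ⟨g1, g2, g3⟩
      have h2 := h g hg
      rw [hg.inner_toL2] at h2
      rw [← setIntegral_eq_integral_of_forall_compl_eq_zero (s := Ω), ← h2]
      · refine integral_congr_ae (Eventually.of_forall fun x => ?_)
        simp [mul_comm]
      · intro x hx
        rw [image_eq_zero_of_notMem_tsupport (fun hx' => hx (g3 hx')), zero_smul]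
  refine Lp.eq_zero_iff_ae_eq_zero.2 ?_
  exact (ae_restrict_iff' hΩ.measurableSet).2 h1

/-- The orthogonal complement vanishes by the fundamental lemma of the calculus of variations. -/
lemma dense_testSubmodule (hΩ : IsOpen Ω) : Dense (testSubmodule Ω : Set (L2 Ω)) := by
  rw [Submodule.dense_iff_topologicalClosure_eq_top, Submodule.topologicalClosure_eq_top_iff,
    Submodule.eq_bot_iff]
  intro u hu
  refine eq_zero_of_forall_test hΩ fun ψ hψ => ?_
  rw [real_inner_comm]
  exact (Submodule.mem_orthogonal _ _).1 hu _ ⟨ψ, hψ, rfl⟩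

/-! ### Weak derivatives -/

lemma isWeakPartial_iff {i : Fin n} {u g : L2 Ω} :
    IsWeakPartial i u g ↔ ∀ (ψ : E n → ℝ) (h : IsTestFunction Ω ψ),
      inner ℝ u (h.partialDeriv i).toL2 = - inner ℝ g h.toL2 := by
  refine forall_congr' fun ψ => forall_congr' fun h => ?_
  rw [IsTestFunction.inner_toL2, IsTestFunction.inner_toL2]
  rfl

lemma IsWeakPartial.unique (hΩ : IsOpen Ω) {i : Fin n} {u g g' : L2 Ω} (h : IsWeakPartial i u g)
    (h' : IsWeakPartial i u g') : g = g' := by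
  rw [← sub_eq_zero]
  refine eq_zero_of_forall_test hΩ fun ψ hψ => ?_
  rw [inner_sub_left]
  linarith [isWeakPartial_iff.1 h ψ hψ, isWeakPartial_iff.1 h' ψ hψ]

lemma IsWeakPartial.pd_eq (hΩ : IsOpen Ω) {i : Fin n} {u g : L2 Ω} (h : IsWeakPartial i u g) :
    pd i u = g := by
  have hex : ∃ g : L2 Ω, IsWeakPartial i u g := ⟨g, h⟩
  rw [pd, dif_pos hex]
  exact hex.choose_spec.unique hΩ h

lemma MemH1.isWeakPartial {u : L2 Ω} (h : MemH1 u) (i : Fin n) : IsWeakPartial i u (pd i u) := by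
  rw [pd, dif_pos (h i)]
  exact (h i).choose_spec

lemma IsWeakPartial.add {i : Fin n} {u g u' g' : L2 Ω} (h : IsWeakPartial i u g)
    (h' : IsWeakPartial i u' g') : IsWeakPartial i (u + u') (g + g') := by
  rw [isWeakPartial_iff] at *
  intro ψ hψ
  rw [inner_add_left, inner_add_left, h _ hψ, h' _ hψ]; ring

lemma IsWeakPartial.smul {i : Fin n} {u g : L2 Ω} (h : IsWeakPartial i u g) (c : ℝ) :
    IsWeakPartial i (c • u) (c • g) := by
  rw [isWeakPartial_iff] at *
  intro ψ hψ
  rw [real_inner_smul_left, real_inner_smul_left, h _ hψ]; ring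

/-- For a fixed test function the defining identity is linear and weakly continuous in the pair.
Closedness of the Sobolev spaces rests on this. -/
lemma IsWeakPartial.of_tendsto_weakly {i : Fin n} {u g : L2 Ω} {ι : Type*} {l : Filter ι} [l.NeBot]
    {U G : ι → L2 Ω} (h : ∀ k, IsWeakPartial i (U k) (G k))
    (hU : ∀ w, Tendsto (fun k => inner ℝ (U k) w) l (𝓝 (inner ℝ u w)))
    (hG : ∀ w, Tendsto (fun k => inner ℝ (G k) w) l (𝓝 (inner ℝ g w))) : IsWeakPartial i u g := by
  rw [isWeakPartial_iff]
  intro ψ hψ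
  refine tendsto_nhds_unique (hU _) ?_
  refine (hG hψ.toL2).neg.congr fun k => ?_
  exact (isWeakPartial_iff.1 (h k) ψ hψ).symm

lemma IsWeakPartial.of_tendsto {i : Fin n} {u g : L2 Ω} {ι : Type*} {l : Filter ι} [l.NeBot]
    {U G : ι → L2 Ω} (h : ∀ k, IsWeakPartial i (U k) (G k))
    (hU : Tendsto U l (𝓝 u)) (hG : Tendsto G l (𝓝 g)) : IsWeakPartial i u g :=
  of_tendsto_weakly h (fun _ => hU.inner tendsto_const_nhds) fun _ => hG.inner tendsto_const_nhds

lemma IsTestFunction.isWeakPartial {ψ : E n → ℝ} (h : IsTestFunction Ω ψ) (i : Fin n) :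
    IsWeakPartial i h.toL2 (h.partialDeriv i).toL2 := by
  rw [isWeakPartial_iff]
  intro χ hχ
  have e : ∀ {f g : E n → ℝ} (hf : IsTestFunction Ω f) (hg : IsTestFunction Ω g),
      inner ℝ hf.toL2 hg.toL2 = ∫ x, f x * g x := by
    intro f g hf hg
    rw [hg.inner_toL2,
      ← setIntegral_eq_integral_of_forall_compl_eq_zero (s := Ω) (f := fun x => f x * g x)]
    · refine integral_congr_ae ?_
      filter_upwards [hf.coeFn_toL2] with x hx
      rw [hx]
    · intro x hx
      rw [image_eq_zero_of_notMem_tsupport (fun hx' => hx (hf.2.2 hx')), zero_mul]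
  have hi : ∀ {f g : E n → ℝ} (hf : IsTestFunction Ω f) (hg : IsTestFunction Ω g),
      Integrable fun x => f x * g x := fun hf hg =>
    (hf.1.continuous.mul hg.1.continuous).integrable_of_hasCompactSupport hf.2.1.mul_right
  rw [e, e]
  exact integral_mul_fderiv_eq_neg_fderiv_mul_of_integrable (hi (h.partialDeriv i) hχ)
    (hi h (hχ.partialDeriv i)) (hi h hχ) (fun x _ => h.1.differentiable (by simp) x)
    (fun x _ => hχ.1.differentiable (by simp) x)

lemma IsTestFunction.memH1 {ψ : E n → ℝ} (h : IsTestFunction Ω ψ) : MemH1 h.toL2 :=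
  fun i => ⟨_, h.isWeakPartial i⟩

lemma IsTestFunction.pd_toL2 (hΩ : IsOpen Ω) {ψ : E n → ℝ} (h : IsTestFunction Ω ψ) (i : Fin n) :
    pd i h.toL2 = (h.partialDeriv i).toL2 := (h.isWeakPartial i).pd_eq hΩ

lemma MemH1.add {u v : L2 Ω} (hu : MemH1 u) (hv : MemH1 v) : MemH1 (u + v) :=
  fun i => ⟨_, (hu.isWeakPartial i).add (hv.isWeakPartial i)⟩

lemma MemH1.smul {u : L2 Ω} (hu : MemH1 u) (c : ℝ) : MemH1 (c • u) :=
  fun i => ⟨_, (hu.isWeakPartial i).smul c⟩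

lemma MemH1.sub {u v : L2 Ω} (hu : MemH1 u) (hv : MemH1 v) : MemH1 (u - v) := by
  rw [sub_eq_add_neg, ← neg_one_smul ℝ v]
  exact hu.add (hv.smul _)

lemma pd_add (hΩ : IsOpen Ω) {u v : L2 Ω} (hu : MemH1 u) (hv : MemH1 v) (i : Fin n) :
    pd i (u + v) = pd i u + pd i v :=
  ((hu.isWeakPartial i).add (hv.isWeakPartial i)).pd_eq hΩ

lemma pd_smul (hΩ : IsOpen Ω) {u : L2 Ω} (hu : MemH1 u) (c : ℝ) (i : Fin n) :
    pd i (c • u) = c • pd i u :=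
  ((hu.isWeakPartial i).smul c).pd_eq hΩ

lemma pd_sub (hΩ : IsOpen Ω) {u v : L2 Ω} (hu : MemH1 u) (hv : MemH1 v) (i : Fin n) :
    pd i (u - v) = pd i u - pd i v := by
  rw [sub_eq_add_neg, ← neg_one_smul ℝ v, pd_add hΩ hu (hv.smul _), pd_smul hΩ hv, neg_one_smul,
    sub_eq_add_neg]

/-! ### The Hilbert space `H¹₀` -/

/-- The ambient Hilbert space of a function and its first derivatives. -/
abbrev Jet (Ω : Set (E n)) : Type := PiLp 2 (fun _ : Option (Fin n) => L2 Ω)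

/-- A function together with its first weak derivatives. -/
def jet (u : L2 Ω) : Jet Ω := WithLp.toLp 2 fun o => o.elim u fun i => pd i u

@[simp] lemma jet_none (u : L2 Ω) : jet u none = u := rfl

@[simp] lemma jet_some (u : L2 Ω) (i : Fin n) : jet u (some i) = pd i u := rfl

lemma norm_jet (u : L2 Ω) : ‖jet u‖ = normH1 u := by
  rw [PiLp.norm_eq_of_L2, normH1, Fintype.sum_option]
  rfl

lemma jet_add (hΩ : IsOpen Ω) {u v : L2 Ω} (hu : MemH1 u) (hv : MemH1 v) :
    jet (u + v) = jet u + jet v := by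
  ext o : 1
  cases o with
  | none => rfl
  | some i => exact pd_add hΩ hu hv i

lemma jet_smul (hΩ : IsOpen Ω) {u : L2 Ω} (hu : MemH1 u) (c : ℝ) : jet (c • u) = c • jet u := by
  ext o : 1
  cases o with
  | none => rfl
  | some i => exact pd_smul hΩ hu c i

lemma jet_sub (hΩ : IsOpen Ω) {u v : L2 Ω} (hu : MemH1 u) (hv : MemH1 v) :
    jet (u - v) = jet u - jet v := by
  ext o : 1
  cases o with
  | none => rfl
  | some i => exact pd_sub hΩ hu hv i

lemma normH1_add_le (hΩ : IsOpen Ω) {u v : L2 Ω} (hu : MemH1 u) (hv : MemH1 v) :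
    normH1 (u + v) ≤ normH1 u + normH1 v := by
  rw [← norm_jet, ← norm_jet, ← norm_jet, jet_add hΩ hu hv]
  exact norm_add_le _ _

lemma normH1_smul (hΩ : IsOpen Ω) {u : L2 Ω} (hu : MemH1 u) (c : ℝ) :
    normH1 (c • u) = |c| * normH1 u := by
  rw [← norm_jet, ← norm_jet, jet_smul hΩ hu, norm_smul, Real.norm_eq_abs]

lemma normH1_nonneg (u : L2 Ω) : 0 ≤ normH1 u := Real.sqrt_nonneg _

lemma norm_le_normH1 (u : L2 Ω) : ‖u‖ ≤ normH1 u := by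
  rw [← norm_jet]
  exact PiLp.norm_apply_le (jet u) none

lemma norm_pd_le_normH1 (u : L2 Ω) (i : Fin n) : ‖pd i u‖ ≤ normH1 u := by
  rw [← norm_jet]
  exact PiLp.norm_apply_le (jet u) (some i)

lemma MemH10.exists_test {u : L2 Ω} (hu : MemH10 u) {ε : ℝ} (hε : 0 < ε) :
    ∃ (ψ : E n → ℝ) (h : IsTestFunction Ω ψ), normH1 (u - h.toL2) < ε := by
  obtain ⟨w, ⟨ψ, h, hw⟩, hd⟩ := hu.2 ε hε
  exact ⟨ψ, h, by rwa [← h.eq_toL2 hw]⟩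

lemma IsTestFunction.memH10 (hΩ : IsOpen Ω) {ψ : E n → ℝ} (h : IsTestFunction Ω ψ) :
    MemH10 h.toL2 := by
  refine ⟨h.memH1, fun ε hε => ⟨_, ⟨ψ, h, h.coeFn_toL2⟩, ?_⟩⟩
  rw [← norm_jet, jet_sub hΩ h.memH1 h.memH1, sub_self, norm_zero]
  exact hε

lemma MemH10.add (hΩ : IsOpen Ω) {u v : L2 Ω} (hu : MemH10 u) (hv : MemH10 v) :
    MemH10 (u + v) := by
  refine ⟨hu.1.add hv.1, fun ε hε => ?_⟩
  obtain ⟨ψ, h, hd⟩ := hu.exists_test (half_pos hε)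
  obtain ⟨χ, h', hd'⟩ := hv.exists_test (half_pos hε)
  obtain ⟨θ, hθ, he⟩ := (testSubmodule Ω).add_mem ⟨ψ, h, rfl⟩ ⟨χ, h', rfl⟩
  refine ⟨h.toL2 + h'.toL2, ⟨θ, hθ, by rw [he]; exact hθ.coeFn_toL2⟩, ?_⟩
  rw [add_sub_add_comm]
  exact (normH1_add_le hΩ (hu.1.sub h.memH1) (hv.1.sub h'.memH1)).trans_lt (by linarith)

lemma MemH10.smul (hΩ : IsOpen Ω) {u : L2 Ω} (hu : MemH10 u) (c : ℝ) : MemH10 (c • u) := by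
  refine ⟨hu.1.smul c, fun ε hε => ?_⟩
  obtain ⟨ψ, h, hd⟩ := hu.exists_test (show 0 < ε / (|c| + 1) by positivity)
  obtain ⟨θ, hθ, he⟩ := (testSubmodule Ω).smul_mem c ⟨ψ, h, rfl⟩
  refine ⟨c • h.toL2, ⟨θ, hθ, by rw [he]; exact hθ.coeFn_toL2⟩, ?_⟩
  rw [← smul_sub, normH1_smul hΩ (hu.1.sub h.memH1)]
  rw [lt_div_iff₀ (by positivity)] at hd
  nlinarith [normH1_nonneg (u - h.toL2)]

lemma MemH10.sub (hΩ : IsOpen Ω) {u v : L2 Ω} (hu : MemH10 u) (hv : MemH10 v) :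
    MemH10 (u - v) := by
  rw [sub_eq_add_neg, ← neg_one_smul ℝ v]
  exact hu.add hΩ (hv.smul hΩ _)

/-- `H¹₀(Ω)` as a space of jets. -/
def h10 (hΩ : IsOpen Ω) : Submodule ℝ (Jet Ω) where
  carrier := {U | ∃ u : L2 Ω, MemH10 u ∧ U = jet u}
  add_mem' := by
    rintro _ _ ⟨u, hu, rfl⟩ ⟨v, hv, rfl⟩
    exact ⟨_, hu.add hΩ hv, (jet_add hΩ hu.1 hv.1).symm⟩
  zero_mem' := by
    refine ⟨_, (IsTestFunction.zero.memH10 hΩ).smul hΩ 0, ?_⟩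
    rw [jet_smul hΩ IsTestFunction.zero.memH1, zero_smul]
  smul_mem' := by
    rintro c _ ⟨u, hu, rfl⟩
    exact ⟨_, hu.smul hΩ c, (jet_smul hΩ hu.1 c).symm⟩

lemma eq_jet_of_isWeakPartial (hΩ : IsOpen Ω) {U : Jet Ω}
    (h : ∀ i, IsWeakPartial i (U none) (U (some i))) : U = jet (U none) := by
  ext o : 1
  cases o with
  | none => rfl
  | some i => exact ((h i).pd_eq hΩ).symm

/-- A limit of jets is again a jet, and a diagonal choice of test functions keeps it in the closure.
`H¹₀(Ω)` thereby becomes a Hilbert space as a closed subspace of a power of `L²(Ω)`. -/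
lemma isClosed_h10 (hΩ : IsOpen Ω) : IsClosed (h10 hΩ : Set (Jet Ω)) := by
  refine isClosed_of_closure_subset fun U hU => ?_
  obtain ⟨V, hV, hlim⟩ := mem_closure_iff_seq_limit.1 hU
  choose v hv hVv using hV
  obtain rfl : V = fun k => jet (v k) := funext hVv
  have hcoord : ∀ o, Tendsto (fun k => jet (v k) o) atTop (𝓝 (U o)) := fun o =>
    ((PiLp.continuous_apply 2 _ o).tendsto U).comp hlim
  have hw : ∀ i, IsWeakPartial i (U none) (U (some i)) := fun i =>
    IsWeakPartial.of_tendsto (fun k => (hv k).1.isWeakPartial i) (hcoord none) (hcoord (some i))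
  have hUj := eq_jet_of_isWeakPartial hΩ hw
  have hH1 : MemH1 (U none) := fun i => ⟨_, hw i⟩
  refine ⟨U none, ⟨hH1, fun ε hε => ?_⟩, hUj⟩
  obtain ⟨k, hk⟩ := ((tendsto_iff_norm_sub_tendsto_zero.1 hlim).eventually
    (gt_mem_nhds (half_pos hε))).exists
  obtain ⟨ψ, h, hd⟩ := (hv k).exists_test (half_pos hε)
  refine ⟨_, ⟨ψ, h, h.coeFn_toL2⟩, ?_⟩
  rw [← sub_add_sub_cancel _ (v k)]
  refine (normH1_add_le hΩ (hH1.sub (hv k).1) ((hv k).1.sub h.memH1)).trans_lt ?_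
  have : normH1 (U none - v k) < ε / 2 := by
    rw [← norm_jet, jet_sub hΩ hH1 (hv k).1, ← hUj, norm_sub_rev]
    exact hk
  linarith

instance completeSpace_h10 (hΩ : IsOpen Ω) : CompleteSpace (h10 hΩ) :=
  (isClosed_h10 hΩ).completeSpace_coe

lemma memH10_of_mem_h10 {hΩ : IsOpen Ω} (U : h10 hΩ) : MemH10 ((U : Jet Ω) none) := by
  obtain ⟨_, u, hu, rfl⟩ := U
  exact hu

lemma jet_of_mem_h10 {hΩ : IsOpen Ω} (U : h10 hΩ) : jet ((U : Jet Ω) none) = U := by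
  obtain ⟨_, u, hu, rfl⟩ := U
  rfl

/-! ### The Rellich theorem -/

open scoped SchwartzMap FourierTransform LineDeriv

/-- A test function as a complex valued Schwartz function. -/
def IsTestFunction.toSchwartz {ψ : E n → ℝ} (h : IsTestFunction Ω ψ) : 𝓢(E n, ℂ) :=
  HasCompactSupport.toSchwartzMap (f := fun x => (ψ x : ℂ))
    (h.2.1.comp_left (g := fun t : ℝ => (t : ℂ)) Complex.ofReal_zero)
    (Complex.ofRealCLM.contDiff.comp h.1)

lemma IsTestFunction.toSchwartz_apply {ψ : E n → ℝ} (h : IsTestFunction Ω ψ) (x : E n) :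
    h.toSchwartz x = (ψ x : ℂ) := rfl

lemma IsTestFunction.norm_toL2_sq {ψ : E n → ℝ} (h : IsTestFunction Ω ψ) :
    ‖h.toL2‖ ^ 2 = ∫ x, ‖h.toSchwartz x‖ ^ 2 := by
  rw [← real_inner_self_eq_norm_sq, h.inner_toL2,
    ← setIntegral_eq_integral_of_forall_compl_eq_zero (s := Ω)
      (f := fun x => ‖h.toSchwartz x‖ ^ 2)]
  · refine integral_congr_ae ?_
    filter_upwards [h.coeFn_toL2] with x hx
    rw [hx, h.toSchwartz_apply, Complex.norm_real, Real.norm_eq_abs, sq_abs, sq]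
  · intro x hx
    rw [h.toSchwartz_apply, image_eq_zero_of_notMem_tsupport (fun hx' => hx (h.2.2 hx'))]
    simp

lemma IsTestFunction.norm_toL2_sq_eq_fourier {ψ : E n → ℝ} (h : IsTestFunction Ω ψ) :
    ‖h.toL2‖ ^ 2 = ∫ ξ, ‖𝓕 h.toSchwartz ξ‖ ^ 2 := by
  rw [h.norm_toL2_sq, SchwartzMap.integral_norm_sq_fourier]

lemma IsTestFunction.toSchwartz_partialDeriv {ψ : E n → ℝ} (h : IsTestFunction Ω ψ) (i : Fin n) :
    (h.partialDeriv i).toSchwartz = ∂_{(EuclideanSpace.single i 1 : E n)} h.toSchwartz := by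
  ext x
  rw [SchwartzMap.lineDerivOp_apply_eq_fderiv]
  have h1 : HasFDerivAt ψ (fderiv ℝ ψ x) x := (h.1.differentiable (by simp) x).hasFDerivAt
  have h2 : HasFDerivAt (fun x => (ψ x : ℂ)) (Complex.ofRealCLM.comp (fderiv ℝ ψ x)) x :=
    Complex.ofRealCLM.hasFDerivAt.comp x h1
  have h3 : fderiv ℝ (h.toSchwartz : E n → ℂ) x = Complex.ofRealCLM.comp (fderiv ℝ ψ x) := h2.fderiv
  rw [h3, toSchwartz_apply]
  rfl

lemma IsTestFunction.norm_fourier_partialDeriv {ψ : E n → ℝ} (h : IsTestFunction Ω ψ) (i : Fin n)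
    (ξ : E n) : ‖𝓕 (h.partialDeriv i).toSchwartz ξ‖ = 2 * Real.pi * |ξ i| * ‖𝓕 h.toSchwartz ξ‖ := by
  rw [h.toSchwartz_partialDeriv, SchwartzMap.fourier_lineDerivOp_eq, smul_apply,
    SchwartzMap.smulLeftCLM_apply_apply (by fun_prop)]
  simp [EuclideanSpace.inner_single_right, abs_of_pos Real.pi_pos, mul_assoc]

lemma IsTestFunction.integrable_fourier_sq {ψ : E n → ℝ} (h : IsTestFunction Ω ψ) :
    Integrable fun ξ => ‖𝓕 h.toSchwartz ξ‖ ^ 2 :=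
  (memLp_two_iff_integrable_sq_norm (𝓕 h.toSchwartz).continuous.aestronglyMeasurable).1
    ((𝓕 h.toSchwartz).memLp 2)

/-- The low frequencies control the `L²` norm up to a small multiple of the `H¹` norm. -/
lemma IsTestFunction.norm_sq_le_low_frequencies (hΩ : IsOpen Ω) {ψ : E n → ℝ}
    (h : IsTestFunction Ω ψ) {R : ℝ} (hR : 0 < R) :
    ‖h.toL2‖ ^ 2 ≤ (∫ ξ in Metric.ball (0 : E n) R, ‖𝓕 h.toSchwartz ξ‖ ^ 2)
      + normH1 h.toL2 ^ 2 / R ^ 2 := by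
  rw [h.norm_toL2_sq_eq_fourier,
    ← integral_add_compl (measurableSet_ball (x := (0 : E n)) (ε := R)) h.integrable_fourier_sq]
  gcongr
  -- High frequencies: by Plancherel the gradient carries the weight `(2π|ξ|)²`, which is at least
  -- `R²` outside the ball.
  have h1 : ∑ i, ‖(h.partialDeriv i).toL2‖ ^ 2 ≤ normH1 h.toL2 ^ 2 := by
    rw [normH1, Real.sq_sqrt (by positivity)]
    simp only [h.pd_toL2 hΩ]
    linarith [sq_nonneg ‖h.toL2‖]
  rw [le_div_iff₀ (by positivity)]
  refine le_trans ?_ h1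
  simp only [IsTestFunction.norm_toL2_sq_eq_fourier]
  rw [← integral_finsetSum _ fun i _ => (h.partialDeriv i).integrable_fourier_sq,
    mul_comm, ← integral_const_mul]
  have hint : Integrable fun ξ => ∑ i, ‖𝓕 (h.partialDeriv i).toSchwartz ξ‖ ^ 2 :=
    integrable_finsetSum _ fun i _ => (h.partialDeriv i).integrable_fourier_sq
  refine le_trans ?_ (setIntegral_le_integral (s := (Metric.ball (0 : E n) R)ᶜ) hint
    (Eventually.of_forall fun ξ => by positivity))
  refine setIntegral_mono_on (h.integrable_fourier_sq.const_mul _).integrableOn hint.integrableOn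
    measurableSet_ball.compl fun ξ hξ => ?_
  have hξ' : R ≤ ‖ξ‖ := by simpa using hξ
  simp only [h.norm_fourier_partialDeriv]
  calc R ^ 2 * ‖𝓕 h.toSchwartz ξ‖ ^ 2 ≤ ‖ξ‖ ^ 2 * ‖𝓕 h.toSchwartz ξ‖ ^ 2 := by gcongr
    _ = ∑ i, |ξ i| ^ 2 * ‖𝓕 h.toSchwartz ξ‖ ^ 2 := by
      rw [EuclideanSpace.norm_sq_eq, Finset.sum_mul]; rfl
    _ ≤ ∑ i, (2 * Real.pi * |ξ i| * ‖𝓕 h.toSchwartz ξ‖) ^ 2 := by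
      refine Finset.sum_le_sum fun i _ => ?_
      rw [← mul_pow]
      refine pow_le_pow_left₀ (by positivity) ?_ 2
      gcongr
      refine le_mul_of_one_le_left (abs_nonneg _) ?_
      linarith [Real.pi_gt_three]

lemma memLp_of_continuous_of_le_one [IsFiniteMeasure (volume.restrict Ω)] {g : E n → ℝ}
    (hg : Continuous g) (hb : ∀ x, |g x| ≤ 1) : MemLp g 2 (volume.restrict Ω) :=
  MemLp.of_bound hg.aestronglyMeasurable 1 (Eventually.of_forall hb)

/-- On a set of finite measure the functions `cos` and `sin` of the phase lie in `L²`, with norms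
bounded independently of `ξ`. Weak convergence in `L²(Ω)` thus becomes pointwise convergence of
Fourier transforms, with a uniform bound. -/
lemma IsTestFunction.fourier_eq_inner (Ω : Set (E n))
    [IsFiniteMeasure (volume.restrict Ω)] : ∃ M : ℝ, 0 ≤ M ∧ ∀ ξ : E n,
    ∃ c s : L2 Ω, ‖c‖ ≤ M ∧ ‖s‖ ≤ M ∧ ∀ (ψ : E n → ℝ) (h : IsTestFunction Ω ψ),
      𝓕 h.toSchwartz ξ = (inner ℝ h.toL2 c : ℝ) + (inner ℝ h.toL2 s : ℝ) * Complex.I := by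
  refine ⟨measureUnivNNReal (volume.restrict Ω) ^ (ENNReal.toReal 2)⁻¹ * 1, by positivity,
    fun ξ => ?_⟩
  have hc : MemLp (fun x : E n => Real.cos (-2 * Real.pi * inner ℝ x ξ)) 2 (volume.restrict Ω) :=
    memLp_of_continuous_of_le_one (by fun_prop) fun x => Real.abs_cos_le_one _
  have hs : MemLp (fun x : E n => Real.sin (-2 * Real.pi * inner ℝ x ξ)) 2 (volume.restrict Ω) :=
    memLp_of_continuous_of_le_one (by fun_prop) fun x => Real.abs_sin_le_one _
  have hn : ∀ {g : E n → ℝ} (hg : MemLp g 2 (volume.restrict Ω)), (∀ x, |g x| ≤ 1) →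
      ‖hg.toLp g‖ ≤ measureUnivNNReal (volume.restrict Ω) ^ (ENNReal.toReal 2)⁻¹ * 1 := by
    intro g hg hg1
    refine Lp.norm_le_of_ae_bound zero_le_one ?_
    filter_upwards [hg.coeFn_toLp] with x hx
    rw [hx]
    exact hg1 x
  refine ⟨hc.toLp _, hs.toLp _, hn hc fun x => Real.abs_cos_le_one _,
    hn hs fun x => Real.abs_sin_le_one _, fun ψ h => ?_⟩
  have e : ∀ {g : E n → ℝ} (hg : MemLp g 2 (volume.restrict Ω)),
      inner ℝ h.toL2 (hg.toLp g) = ∫ x, ψ x * g x := by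
    intro g hg
    rw [inner_eq_integral,
      ← setIntegral_eq_integral_of_forall_compl_eq_zero (s := Ω) (f := fun x => ψ x * g x)]
    · refine integral_congr_ae ?_
      filter_upwards [h.coeFn_toL2, hg.coeFn_toLp] with x hx hx'
      rw [hx, hx']
    · intro x hx
      rw [image_eq_zero_of_notMem_tsupport (fun hx' => hx (h.2.2 hx')), zero_mul]
  have hint : ∀ {g : E n → ℝ}, Continuous g → Integrable fun x => ((ψ x * g x : ℝ) : ℂ) :=
    fun hg => ((h.1.continuous.mul hg).integrable_of_hasCompactSupport h.2.1.mul_right).ofReal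
  rw [e hc, e hs, ← integral_complex_ofReal, ← integral_complex_ofReal, ← integral_mul_const,
    ← integral_add (hint (by fun_prop)) ((hint (by fun_prop)).mul_const _), SchwartzMap.fourier_coe,
    Real.fourier_eq']
  refine integral_congr_ae (Eventually.of_forall fun x => ?_)
  simp only [h.toSchwartz_apply, smul_eq_mul]
  rw [Complex.exp_mul_I, ← Complex.ofReal_cos, ← Complex.ofReal_sin]
  push_cast
  ring

/-- Frequencies above `R` carry at most `C² / R²` of the squared norm; on the ball of radius `R` the
transforms tend to zero pointwise and boundedly, so dominated convergence applies. -/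
lemma tendsto_zero_of_test [IsFiniteMeasure (volume.restrict Ω)] (hΩ : IsOpen Ω)
    {ψ : ℕ → E n → ℝ} (h : ∀ k, IsTestFunction Ω (ψ k)) {C : ℝ}
    (hC : ∀ k, normH1 (h k).toL2 ≤ C)
    (hw : ∀ w : L2 Ω, Tendsto (fun k => inner ℝ (h k).toL2 w) atTop (𝓝 0)) :
    Tendsto (fun k => ‖(h k).toL2‖) atTop (𝓝 0) := by
  have hC0 : 0 ≤ C := (normH1_nonneg _).trans (hC 0)
  obtain ⟨M, hM0, hM⟩ := IsTestFunction.fourier_eq_inner Ω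
  have hlow : ∀ R : ℝ, Tendsto (fun k => ∫ ξ in Metric.ball (0 : E n) R,
      ‖𝓕 (h k).toSchwartz ξ‖ ^ 2) atTop (𝓝 0) := by
    intro R
    have hpt : ∀ ξ : E n, Tendsto (fun k => 𝓕 (h k).toSchwartz ξ) atTop (𝓝 0) := by
      intro ξ
      obtain ⟨c, s, -, -, hcs⟩ := hM ξ
      simp only [hcs]
      have h1 := (Complex.continuous_ofReal.tendsto 0).comp (hw c)
      have h2 := ((Complex.continuous_ofReal.tendsto 0).comp (hw s)).mul_const Complex.I
      simpa using h1.add h2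
    have hbd : ∀ k ξ, ‖𝓕 (h k).toSchwartz ξ‖ ≤
        2 * (C * M) := by
      intro k ξ
      obtain ⟨c, s, hc, hs, hcs⟩ := hM ξ
      have hb : ∀ w : L2 Ω, ‖w‖ ≤ M → |inner ℝ (h k).toL2 w| ≤ C * M := fun w hw =>
        (abs_real_inner_le_norm _ _).trans (mul_le_mul ((norm_le_normH1 _).trans (hC k)) hw
          (norm_nonneg _) hC0)
      rw [hcs]
      refine (norm_add_le _ _).trans ?_
      rw [norm_mul, Complex.norm_I, mul_one, Complex.norm_real, Complex.norm_real]
      linarith [hb c hc, hb s hs, Real.norm_eq_abs (inner ℝ (h k).toL2 c),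
        Real.norm_eq_abs (inner ℝ (h k).toL2 s)]
    have : IsFiniteMeasure (volume.restrict (Metric.ball (0 : E n) R)) :=
      ⟨by simpa using measure_ball_lt_top⟩
    have := tendsto_integral_of_dominated_convergence (μ := volume.restrict (Metric.ball (0 : E n) R))
      (F := fun k ξ => ‖𝓕 (h k).toSchwartz ξ‖ ^ 2) (f := fun _ => 0)
      (fun _ => (2 * (C * M)) ^ 2)
      (fun k => ((𝓕 (h k).toSchwartz).continuous.norm.pow 2).aestronglyMeasurable)
      (integrable_const _) (fun k => Eventually.of_forall fun ξ => ?_)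
      (Eventually.of_forall fun ξ => ?_)
    · simpa using this
    · rw [norm_pow, norm_norm]
      exact pow_le_pow_left₀ (norm_nonneg _) (hbd k ξ) 2
    · simpa using (hpt ξ).norm.pow 2
  have hsq : Tendsto (fun k => ‖(h k).toL2‖ ^ 2) atTop (𝓝 0) := by
    rw [Metric.tendsto_atTop]
    intro ε hε
    -- Chosen so that `C ^ 2 / R ^ 2 ≤ ε / 2`; the `+ 1` keeps `R` positive when `C = 0`.
    set R : ℝ := Real.sqrt (2 * (C ^ 2 + 1) / ε) with hR
    have hR0 : 0 < R := by positivity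
    have hRsq : R ^ 2 = 2 * (C ^ 2 + 1) / ε := Real.sq_sqrt (by positivity)
    obtain ⟨N, hN⟩ := Metric.tendsto_atTop.1 (hlow R) (ε / 2) (half_pos hε)
    refine ⟨N, fun k hk => ?_⟩
    have h1 := hN k hk
    rw [Real.dist_eq, sub_zero] at h1 ⊢
    rw [abs_of_nonneg (by positivity)]
    have h2 := (h k).norm_sq_le_low_frequencies hΩ hR0
    have h3 : normH1 (h k).toL2 ^ 2 / R ^ 2 ≤ ε / 2 := by
      rw [hRsq, div_le_iff₀ (by positivity)]
      have : normH1 (h k).toL2 ^ 2 ≤ C ^ 2 := pow_le_pow_left₀ (normH1_nonneg _) (hC k) 2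
      calc normH1 (h k).toL2 ^ 2 ≤ C ^ 2 + 1 := by linarith
        _ = ε / 2 * (2 * (C ^ 2 + 1) / ε) := by field_simp
    linarith [le_abs_self (∫ ξ in Metric.ball (0 : E n) R, ‖𝓕 (h k).toSchwartz ξ‖ ^ 2)]
  have := hsq.sqrt
  simpa using this

/-- The **Rellich theorem**: sequences which are bounded in `H¹₀(Ω)` and converge weakly to zero in
`L²(Ω)` converge strongly to zero in `L²(Ω)`. -/
theorem rellich (hΩ : IsOpen Ω) (hb : Bornology.IsBounded Ω) {u : ℕ → L2 Ω}
    (hu : ∀ k, MemH10 (u k)) {C : ℝ} (hC : ∀ k, normH1 (u k) ≤ C)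
    (hw : ∀ w : L2 Ω, Tendsto (fun k => inner ℝ (u k) w) atTop (𝓝 0)) :
    Tendsto u atTop (𝓝 0) := by
  have : IsFiniteMeasure (volume.restrict Ω) := ⟨by simpa using hb.measure_lt_top⟩
  -- Test functions within `1 / (k + 1)` of `u k` in `H¹` inherit the bound and the weak limit.
  choose ψ h hd using fun k : ℕ => (hu k).exists_test (Nat.one_div_pos_of_nat (α := ℝ) (n := k))
  have h0 : Tendsto (fun k => u k - (h k).toL2) atTop (𝓝 0) :=
    squeeze_zero_norm (fun k => (norm_le_normH1 _).trans (hd k).le)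
      tendsto_one_div_add_atTop_nhds_zero_nat
  have h1 : Tendsto (fun k => ‖(h k).toL2‖) atTop (𝓝 0) := by
    refine tendsto_zero_of_test hΩ h (C := C + 1) (fun k => ?_) fun w => ?_
    · have h2 : normH1 (h k).toL2 ≤ normH1 (u k) + normH1 (u k - (h k).toL2) := by
        rw [← norm_jet, ← norm_jet, ← norm_jet, jet_sub hΩ (hu k).1 (h k).memH1]
        have := norm_sub_norm_le (jet (h k).toL2) (jet (u k))
        rw [norm_sub_rev] at this
        linarith
      have h3 : (1 : ℝ) / (k + 1) ≤ 1 := by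
        rw [div_le_one (by positivity)]
        linarith [Nat.cast_nonneg (α := ℝ) k]
      linarith [hC k, hd k]
    · have := (hw w).sub (h0.inner (tendsto_const_nhds (x := w)))
      rw [inner_zero_left, sub_zero] at this
      refine this.congr fun k => ?_
      rw [← inner_sub_left]
      simp
  have := h0.add (tendsto_zero_iff_norm_tendsto_zero.2 h1)
  simpa using this

/-! ### Bounded multipliers -/

/-- Multiplication by a bounded function on `L²(Ω)`. -/
def mulOp {a : E n → ℝ} (ha : MemLp a ⊤ (volume.restrict Ω)) : L2 Ω →L[ℝ] L2 Ω :=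
  (ContinuousLinearMap.mul ℝ ℝ).holderL (volume.restrict Ω) ⊤ 2 2 (ha.toLp a)

lemma coeFn_mulOp {a : E n → ℝ} (ha : MemLp a ⊤ (volume.restrict Ω)) (u : L2 Ω) :
    mulOp ha u =ᵐ[volume.restrict Ω] fun x => a x * u x := by
  have h := (ContinuousLinearMap.mul ℝ ℝ).coeFn_holder (r := 2) (ha.toLp a) u
  filter_upwards [h, ha.coeFn_toLp] with x h1 h2
  rw [h2] at h1
  exact h1

lemma inner_mulOp {a : E n → ℝ} (ha : MemLp a ⊤ (volume.restrict Ω)) (u v : L2 Ω) :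
    inner ℝ (mulOp ha u) v = ∫ x in Ω, a x * u x * v x := by
  rw [inner_eq_integral]
  refine integral_congr_ae ?_
  filter_upwards [coeFn_mulOp ha u] with x hx
  rw [hx]

lemma integrable_mul_mul {a : E n → ℝ} (ha : MemLp a ⊤ (volume.restrict Ω)) (u v : L2 Ω) :
    Integrable (fun x => a x * u x * v x) (volume.restrict Ω) := by
  refine (L2.integrable_inner (𝕜 := ℝ) (mulOp ha u) v).congr ?_
  filter_upwards [coeFn_mulOp ha u] with x hx
  simp [hx, mul_comm]

lemma abs_integral_mul_mul_le {a : E n → ℝ} (ha : MemLp a ⊤ (volume.restrict Ω)) {M : ℝ}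
    (hM : ∀ᵐ x ∂(volume.restrict Ω), |a x| ≤ M) (u v : L2 Ω) :
    |∫ x in Ω, a x * u x * v x| ≤ M * ‖u‖ * ‖v‖ := by
  rw [← inner_mulOp ha]
  refine (abs_real_inner_le_norm _ _).trans (mul_le_mul_of_nonneg_right ?_ (norm_nonneg _))
  refine Lp.norm_le_mul_norm_of_ae_le_mul ?_
  filter_upwards [coeFn_mulOp ha u, hM] with x hx hx'
  rw [hx, norm_mul]
  exact mul_le_mul_of_nonneg_right hx' (norm_nonneg _)

lemma exists_abs_integral_mul_mul_le {a : E n → ℝ} (ha : MemLp a ⊤ (volume.restrict Ω)) :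
    ∃ M : ℝ, 0 ≤ M ∧ ∀ u v : L2 Ω, |∫ x in Ω, a x * u x * v x| ≤ M * ‖u‖ * ‖v‖ := by
  refine ⟨‖mulOp ha‖, norm_nonneg _, fun u v => ?_⟩
  rw [← inner_mulOp ha]
  exact (abs_real_inner_le_norm _ _).trans
    (mul_le_mul_of_nonneg_right ((mulOp ha).le_opNorm u) (norm_nonneg _))

/-! ### The bilinear form -/

/-- The form is represented by a bounded operator on jets. -/
lemma Coeffs.Admissible.exists_operator {c : Coeffs n} (hc : c.Admissible Ω) :
    ∃ A : Jet Ω →L[ℝ] Jet Ω, ∀ u v : L2 Ω, c.form u v = inner ℝ (A (jet u)) (jet v) := by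
  let P : Option (Fin n) → Jet Ω →L[ℝ] L2 Ω := fun o => PiLp.proj 2 (fun _ => L2 Ω) o
  -- Entry `some j` collects what multiplies `∂ⱼv` in the form, entry `none` what multiplies `v`.
  let B : Option (Fin n) → Jet Ω →L[ℝ] L2 Ω := fun o => o.elim
    ((∑ i, (mulOp (hc.a1_bdd i)).comp (P (some i))) + (mulOp hc.a0_bdd).comp (P none))
    fun j => ∑ i, (mulOp (hc.a2_bdd i j)).comp (P (some i))
  refine ⟨(PiLp.continuousLinearEquiv 2 ℝ fun _ : Option (Fin n) => L2 Ω).symm.toContinuousLinearMap.comp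
    (ContinuousLinearMap.pi B), fun u v => ?_⟩
  have e : ∀ o, ((PiLp.continuousLinearEquiv 2 ℝ
      fun _ : Option (Fin n) => L2 Ω).symm.toContinuousLinearMap.comp
      (ContinuousLinearMap.pi B)) (jet u) o = B o (jet u) := fun o => rfl
  rw [PiLp.inner_apply, Fintype.sum_option, e]
  simp only [e]
  have e0 : B none (jet u) =
      (∑ i, mulOp (hc.a1_bdd i) (pd i u)) + mulOp hc.a0_bdd u := by
    simp [B, P]
  have e1 : ∀ j, B (some j) (jet u) = ∑ i, mulOp (hc.a2_bdd i j) (pd i u) := by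
    intro j
    simp [B, P]
  rw [e0]
  simp only [e1, jet_none, jet_some, inner_add_left, sum_inner, inner_mulOp]
  rw [Finset.sum_comm, Coeffs.form]
  ring

lemma Coeffs.Admissible.form_sub_left (hΩ : IsOpen Ω) {c : Coeffs n} (hc : c.Admissible Ω)
    {u u' : L2 Ω} (hu : MemH1 u) (hu' : MemH1 u') (v : L2 Ω) :
    c.form (u - u') v = c.form u v - c.form u' v := by
  obtain ⟨A, hA⟩ := hc.exists_operator
  rw [hA, hA, hA, jet_sub hΩ hu hu', map_sub, inner_sub_left]

lemma Coeffs.Admissible.form_sub_right (hΩ : IsOpen Ω) {c : Coeffs n} (hc : c.Admissible Ω)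
    (u : L2 Ω) {v v' : L2 Ω} (hv : MemH1 v) (hv' : MemH1 v') :
    c.form u (v - v') = c.form u v - c.form u v' := by
  obtain ⟨A, hA⟩ := hc.exists_operator
  rw [hA, hA, hA, jet_sub hΩ hv hv', inner_sub_right]

lemma Coeffs.Admissible.exists_form_le {c : Coeffs n} (hc : c.Admissible Ω) :
    ∃ M : ℝ, 0 ≤ M ∧ ∀ u v : L2 Ω, |c.form u v| ≤ M * normH1 u * normH1 v := by
  obtain ⟨A, hA⟩ := hc.exists_operator
  refine ⟨‖A‖, norm_nonneg _, fun u v => ?_⟩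
  rw [hA, ← norm_jet, ← norm_jet]
  exact (abs_real_inner_le_norm _ _).trans
    (mul_le_mul_of_nonneg_right (A.le_opNorm _) (norm_nonneg _))

/-- Integration by parts against a Lipschitz coefficient. -/
lemma exists_abs_integral_lipschitz_le (hΩ : IsOpen Ω) (hb : Bornology.IsBounded Ω) {a : E n → ℝ}
    (ha : MemLp a ⊤ (volume.restrict Ω)) {K : NNReal} (hK : LipschitzOnWith K a (closure Ω))
    (j : Fin n) :
    ∃ M : ℝ, 0 ≤ M ∧ ∀ g h : L2 Ω, IsWeakPartial j g h → ∀ (ψ : E n → ℝ) (hψ : IsTestFunction Ω ψ),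
      |∫ x in Ω, a x * g x * pd j hψ.toL2 x| ≤ M * (‖g‖ + ‖h‖) * ‖hψ.toL2‖ := by
  obtain ⟨a', ha'K, ha'⟩ := hK.extend_real
  obtain ⟨A, hA⟩ := hb.isCompact_closure.exists_bound_of_continuousOn hK.continuousOn
  refine ⟨|A| + 1 + K, by positivity, fun g h hgh ψ hψ => le_of_forall_pos_le_add fun ε hε => ?_⟩
  -- The tolerance may depend on `g` and `ψ`, because the bounds on the smooth coefficient `G` and
  -- its derivative do not: `|G| ≤ |A| + 1` from `e ≤ 1`, and `|∂ⱼG| ≤ K`.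
  set e : ℝ := min 1 (ε / (‖g‖ * ‖pd j hψ.toL2‖ + 1)) with he
  have he0 : 0 < e := by positivity
  have he1 : e ≤ 1 := min_le_left _ _
  have he2 : e * ‖g‖ * ‖pd j hψ.toL2‖ ≤ ε := by
    have : e ≤ ε / (‖g‖ * ‖pd j hψ.toL2‖ + 1) := min_le_right _ _
    rw [le_div_iff₀ (by positivity)] at this
    linarith
  obtain ⟨G, hG, hGa, hGd⟩ := exists_smooth_approx ha'K he0
  have hGl : LipschitzWith K G := by
    refine LipschitzWith.of_le_add_mul K fun x y => ?_
    have := hGd (x - y) (K * ‖x - y‖) (fun z => by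
      have := (le_abs_self _).trans (ha'K.dist_le_mul (z + (x - y)) z)
      simpa using this) y
    rw [add_sub_cancel] at this
    rw [dist_eq_norm]
    linarith
  have haG : ∀ᵐ x ∂(volume.restrict Ω), |a x - G x| ≤ e := by
    filter_upwards [ae_restrict_mem hΩ.measurableSet] with x hx
    rw [ha' (subset_closure hx), abs_sub_comm]
    exact hGa x
  have hGb : ∀ᵐ x ∂(volume.restrict Ω), |G x| ≤ |A| + 1 := by
    filter_upwards [ae_restrict_mem hΩ.measurableSet] with x hx
    have h1 := hA x (subset_closure hx)
    rw [ha' (subset_closure hx), Real.norm_eq_abs] at h1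
    have h2 := hGa x
    have h3 : |G x| ≤ |G x - a' x| + |a' x| := by
      simpa using abs_add_le (G x - a' x) (a' x)
    linarith [le_abs_self A]
  have hdG : ∀ x, |partialDeriv j G x| ≤ K := by
    intro x
    refine ((fderiv ℝ G x).le_opNorm _).trans ?_
    rw [PiLp.norm_single, norm_one, mul_one]
    exact norm_fderiv_le_of_lipschitz ℝ hGl
  have hGm : MemLp G ⊤ (volume.restrict Ω) :=
    memLp_top_of_bound hG.continuous.aestronglyMeasurable _ hGb
  have hdGm : MemLp (partialDeriv j G) ⊤ (volume.restrict Ω) := by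
    refine memLp_top_of_bound ?_ K (Eventually.of_forall hdG)
    exact ((hG.continuous_fderiv (by simp)).clm_apply continuous_const).aestronglyMeasurable
  have haGm : MemLp (fun x => a x - G x) ⊤ (volume.restrict Ω) := ha.sub hGm
  -- As `G` is smooth, `G * ψ` is an admissible test function in the definition of the weak
  -- derivative of `g`.
  have hχ := hψ.smooth_mul hG
  have hmain : ∫ x in Ω, G x * g x * pd j hψ.toL2 x =
      - (∫ x in Ω, G x * h x * hψ.toL2 x) - ∫ x in Ω, partialDeriv j G x * g x * hψ.toL2 x := by
    have h1 := hgh _ hχ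
    have h2 : ∫ x in Ω, g x * fderiv ℝ (fun x => G x * ψ x) x (EuclideanSpace.single j 1) =
        (∫ x in Ω, G x * g x * pd j hψ.toL2 x) +
          ∫ x in Ω, partialDeriv j G x * g x * hψ.toL2 x := by
      rw [← integral_add (integrable_mul_mul hGm _ _) (integrable_mul_mul hdGm _ _)]
      refine integral_congr_ae ?_
      have hp := (hψ.partialDeriv j).coeFn_toL2
      rw [← hψ.pd_toL2 hΩ] at hp
      filter_upwards [hp, hψ.coeFn_toL2] with x hx hx'
      rw [hx, hx', fderiv_fun_mul (hG.differentiable (by simp) x) (hψ.1.differentiable (by simp) x)]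
      simp only [partialDeriv, add_apply, smul_apply, smul_eq_mul]
      ring
    have h3 : ∫ x in Ω, h x * (G x * ψ x) = ∫ x in Ω, G x * h x * hψ.toL2 x := by
      refine integral_congr_ae ?_
      filter_upwards [hψ.coeFn_toL2] with x hx
      rw [hx]; ring
    rw [h2, h3] at h1
    linarith
  have hsplit : ∫ x in Ω, a x * g x * pd j hψ.toL2 x =
      (∫ x in Ω, (a x - G x) * g x * pd j hψ.toL2 x) + ∫ x in Ω, G x * g x * pd j hψ.toL2 x := by
    rw [← integral_add (integrable_mul_mul haGm _ _) (integrable_mul_mul hGm _ _)]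
    refine integral_congr_ae (Eventually.of_forall fun x => ?_)
    simp only
    ring
  rw [hsplit, hmain]
  have b1 := abs_integral_mul_mul_le haGm haG g (pd j hψ.toL2)
  have b2 := abs_integral_mul_mul_le hGm hGb h hψ.toL2
  have b3 := abs_integral_mul_mul_le hdGm (Eventually.of_forall hdG) g hψ.toL2
  have b4 : (|A| + 1) * ‖h‖ * ‖hψ.toL2‖ + K * ‖g‖ * ‖hψ.toL2‖
      ≤ (|A| + 1 + K) * (‖g‖ + ‖h‖) * ‖hψ.toL2‖ := by
    rw [← add_mul]
    refine mul_le_mul_of_nonneg_right ?_ (norm_nonneg _)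
    have : 0 ≤ (|A| + 1) * ‖g‖ := by positivity
    have : 0 ≤ K * ‖h‖ := by positivity
    linarith
  rw [abs_le] at *
  constructor <;> linarith [b1.1, b1.2, b2.1, b2.2, b3.1, b3.2]

/-! ### Bounds on the form: `H²` first arguments and monotone functions of the argument -/

lemma normH1_le_normH2 (u : L2 Ω) : normH1 u ≤ normH2 u := by
  refine Real.sqrt_le_sqrt ?_
  have : 0 ≤ ∑ i, ∑ j, ‖pd i (pd j u)‖ ^ 2 := by positivity
  linarith

lemma norm_pd_pd_le_normH2 (u : L2 Ω) (i j : Fin n) : ‖pd i (pd j u)‖ ≤ normH2 u := by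
  refine Real.le_sqrt_of_sq_le ?_
  have h1 : ‖pd i (pd j u)‖ ^ 2 ≤ ∑ j, ‖pd i (pd j u)‖ ^ 2 :=
    Finset.single_le_sum (f := fun j => ‖pd i (pd j u)‖ ^ 2) (fun _ _ => by positivity)
      (Finset.mem_univ j)
  have h2 : ∑ j, ‖pd i (pd j u)‖ ^ 2 ≤ ∑ i, ∑ j, ‖pd i (pd j u)‖ ^ 2 :=
    Finset.single_le_sum (f := fun i => ∑ j, ‖pd i (pd j u)‖ ^ 2) (fun _ _ => by positivity)
      (Finset.mem_univ i)
  have : 0 ≤ ‖u‖ ^ 2 + ∑ i, ‖pd i u‖ ^ 2 := by positivity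
  linarith

lemma normH2_nonneg (u : L2 Ω) : 0 ≤ normH2 u := Real.sqrt_nonneg _

/-- For `φ ∈ H²(Ω)` the functional `a(φ, ·)` is bounded for the norm of `L²(Ω)`. -/
lemma Coeffs.Admissible.exists_form_le_normH2 (hΩ : IsOpen Ω) (hb : Bornology.IsBounded Ω)
    {c : Coeffs n} (hc : c.Admissible Ω) :
    ∃ M : ℝ, 0 ≤ M ∧ ∀ φ : L2 Ω, MemH2 φ → ∀ (ψ : E n → ℝ) (hψ : IsTestFunction Ω ψ),
      |c.form φ hψ.toL2| ≤ M * normH2 φ * ‖hψ.toL2‖ := by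
  choose K hK using hc.a2_lip
  choose M2 hM2 hM2' using fun i j => exists_abs_integral_lipschitz_le hΩ hb (hc.a2_bdd i j) (hK i j) j
  choose M1 hM1 hM1' using fun i => exists_abs_integral_mul_mul_le (hc.a1_bdd i)
  obtain ⟨M0, hM0, hM0'⟩ := exists_abs_integral_mul_mul_le hc.a0_bdd
  refine ⟨(∑ i, ∑ j, M2 i j * 2) + ∑ i, M1 i + M0,
    add_nonneg (add_nonneg (Finset.sum_nonneg fun i _ => Finset.sum_nonneg fun j _ =>
      mul_nonneg (hM2 i j) zero_le_two) (Finset.sum_nonneg fun i _ => hM1 i)) hM0, fun φ hφ ψ hψ => ?_⟩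
  have hN := normH2_nonneg φ
  have hpd : ∀ i, ‖pd i φ‖ ≤ normH2 φ := fun i =>
    (norm_pd_le_normH1 φ i).trans (normH1_le_normH2 φ)
  have b2 : |∑ i, ∑ j, ∫ x in Ω, c.a2 i j x * pd i φ x * pd j hψ.toL2 x| ≤
      ∑ i, ∑ j, M2 i j * 2 * normH2 φ * ‖hψ.toL2‖ := by
    refine (Finset.abs_sum_le_sum_abs _ _).trans (Finset.sum_le_sum fun i _ =>
      (Finset.abs_sum_le_sum_abs _ _).trans (Finset.sum_le_sum fun j _ => ?_))
    refine (hM2' i j _ _ ((hφ.2 i).isWeakPartial j) ψ hψ).trans ?_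
    refine mul_le_mul_of_nonneg_right ?_ (norm_nonneg _)
    rw [mul_assoc]
    refine mul_le_mul_of_nonneg_left ?_ (hM2 i j)
    linarith [hpd i, norm_pd_pd_le_normH2 φ j i]
  have b1 : |∑ i, ∫ x in Ω, c.a1 i x * pd i φ x * hψ.toL2 x| ≤
      ∑ i, M1 i * normH2 φ * ‖hψ.toL2‖ := by
    refine (Finset.abs_sum_le_sum_abs _ _).trans (Finset.sum_le_sum fun i _ =>
      (hM1' i _ _).trans ?_)
    have := hM1 i
    gcongr
    exact hpd i
  have b0 : |∫ x in Ω, c.a0 x * φ x * hψ.toL2 x| ≤ M0 * normH2 φ * ‖hψ.toL2‖ := by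
    refine (hM0' _ _).trans ?_
    gcongr
    exact (norm_le_normH1 φ).trans (normH1_le_normH2 φ)
  simp only [← Finset.sum_mul] at b1 b2
  rw [Coeffs.form, add_mul, add_mul, add_mul, add_mul]
  refine (abs_add_le _ _).trans (add_le_add ((abs_add_le _ _).trans (add_le_add ?_ b1)) b0)
  simp only [← Finset.sum_mul]
  exact b2

lemma IsTestFunction.partialDeriv_comp {ψ : E n → ℝ} (hψ : IsTestFunction Ω ψ) {G : ℝ → ℝ}
    (hG : ContDiff ℝ ∞ G) (j : Fin n) (x : E n) :
    ObstacleControl.partialDeriv j (fun x => G (ψ x)) x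
      = deriv G (ψ x) * ObstacleControl.partialDeriv j ψ x := by
  have h1 : HasFDerivAt ψ (fderiv ℝ ψ x) x := (hψ.1.differentiable (by simp) x).hasFDerivAt
  have h2 : HasDerivAt G (deriv G (ψ x)) (ψ x) := (hG.differentiable (by simp) _).hasDerivAt
  have h3 := (h2.comp_hasFDerivAt x h1).fderiv
  simp only [ObstacleControl.partialDeriv]
  rw [show (fun x => G (ψ x)) = G ∘ ψ from rfl, h3]
  rfl

/-- The form tested with an increasing function of its first argument. -/
lemma Coeffs.Admissible.exists_form_comp_ge (hΩ : IsOpen Ω) {c : Coeffs n} (hc : c.Admissible Ω) :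
    ∃ M : ℝ, 0 ≤ M ∧ ∀ (ψ : E n → ℝ) (hψ : IsTestFunction Ω ψ) (G : ℝ → ℝ) (hG : ContDiff ℝ ∞ G)
      (hG0 : G 0 = 0), Monotone G →
      -(M * normH1 hψ.toL2 * ‖(hψ.comp hG hG0).toL2‖) ≤ c.form hψ.toL2 (hψ.comp hG hG0).toL2 := by
  choose M1 hM1 hM1' using fun i => exists_abs_integral_mul_mul_le (hc.a1_bdd i)
  refine ⟨∑ i, M1 i, Finset.sum_nonneg fun i _ => hM1 i, fun ψ hψ G hG hG0 hmono => ?_⟩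
  have hη := hψ.comp hG hG0
  have b1 : |∑ i, ∫ x in Ω, c.a1 i x * pd i hψ.toL2 x * hη.toL2 x| ≤
      (∑ i, M1 i) * normH1 hψ.toL2 * ‖hη.toL2‖ := by
    rw [Finset.sum_mul, Finset.sum_mul]
    refine (Finset.abs_sum_le_sum_abs _ _).trans (Finset.sum_le_sum fun i _ =>
      (hM1' i _ _).trans ?_)
    have := hM1 i
    gcongr
    exact norm_pd_le_normH1 _ _
  have b0 : 0 ≤ ∫ x in Ω, c.a0 x * hψ.toL2 x * hη.toL2 x := by
    refine integral_nonneg_of_ae ?_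
    filter_upwards [hc.a0_nonneg, hψ.coeFn_toL2, hη.coeFn_toL2] with x h0 h1 h2
    rw [h1, h2, mul_assoc]
    refine mul_nonneg h0 ?_
    rcases le_total 0 (ψ x) with h | h
    · exact mul_nonneg h (hG0 ▸ hmono h)
    · exact mul_nonneg_of_nonpos_of_nonpos h (hG0 ▸ hmono h)
  -- By the chain rule the integrand is `G'(ψ) ∑ aᵢⱼ ∂ᵢψ ∂ⱼψ`, a product of nonnegative factors.
  have b2 : 0 ≤ ∑ i, ∑ j, ∫ x in Ω, c.a2 i j x * pd i hψ.toL2 x * pd j hη.toL2 x := by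
    have e : ∑ i, ∑ j, ∫ x in Ω, c.a2 i j x * pd i hψ.toL2 x * pd j hη.toL2 x =
        ∫ x in Ω, ∑ i, ∑ j, c.a2 i j x * pd i hψ.toL2 x * pd j hη.toL2 x := by
      rw [integral_finsetSum _ fun i _ => integrable_finsetSum _ fun j _ =>
        integrable_mul_mul (hc.a2_bdd i j) _ _]
      refine Finset.sum_congr rfl fun i _ => ?_
      rw [integral_finsetSum _ fun j _ => integrable_mul_mul (hc.a2_bdd i j) _ _]
    rw [e]
    refine integral_nonneg_of_ae ?_
    obtain ⟨m, hm, hell⟩ := hc.elliptic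
    have hd : ∀ᵐ x ∂(volume.restrict Ω), ∀ i, pd i hψ.toL2 x = partialDeriv i ψ x := by
      rw [ae_all_iff]
      intro i
      rw [hψ.pd_toL2 hΩ]
      exact (hψ.partialDeriv i).coeFn_toL2
    have hd' : ∀ᵐ x ∂(volume.restrict Ω), ∀ j, pd j hη.toL2 x =
        deriv G (ψ x) * partialDeriv j ψ x := by
      rw [ae_all_iff]
      intro j
      rw [hη.pd_toL2 hΩ]
      filter_upwards [(hη.partialDeriv j).coeFn_toL2] with x hx
      rw [hx, hψ.partialDeriv_comp hG]
    filter_upwards [hell, hd, hd'] with x h1 h2 h3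
    have h4 := h1 fun i => partialDeriv i ψ x
    have h5 : 0 ≤ ∑ i, ∑ j, c.a2 i j x * partialDeriv i ψ x * partialDeriv j ψ x :=
      le_trans (by positivity) h4
    have h6 := mul_nonneg (hmono.deriv_nonneg (x := ψ x)) h5
    rw [Finset.mul_sum] at h6
    simp only [Finset.mul_sum] at h6
    simp only [Pi.zero_apply, h2, h3]
    refine h6.trans_eq (Finset.sum_congr rfl fun i _ => Finset.sum_congr rfl fun j _ => ?_)
    ring
  rw [Coeffs.form]
  linarith [(abs_le.1 b1).1]

/-! ### The penalization operator -/

lemma betaOne_nonpos (r : ℝ) : betaOne r ≤ 0 := by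
  unfold betaOne
  split_ifs <;> nlinarith

lemma betaOne_of_nonneg {r : ℝ} (h : 0 ≤ r) : betaOne r = 0 := by rw [betaOne, if_pos h]

lemma beta_nonpos {δ : ℝ} (hδ : 0 < δ) (r : ℝ) : beta δ r ≤ 0 :=
  mul_nonpos_of_nonneg_of_nonpos (by positivity) (betaOne_nonpos r)

lemma beta_mono {δ : ℝ} (hδ : 0 < δ) : Monotone (beta δ) := fun r s h =>
  mul_le_mul_of_nonneg_left (by linarith [(betaOne_sub r s h).1]) (by positivity)

lemma beta_mul_self_nonneg {δ : ℝ} (hδ : 0 < δ) (r : ℝ) : 0 ≤ beta δ r * r := by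
  rcases le_total 0 r with h | h
  · rw [beta, betaOne_of_nonneg h]; simp
  · exact mul_nonneg_of_nonpos_of_nonpos (beta_nonpos hδ r) h

/-- The negative part is controlled by the penalization. -/
lemma negPart_sq_le {δ : ℝ} (hδ : 0 < δ) (r : ℝ) :
    (max (-r) 0) ^ 2 ≤ 4 * δ ^ 2 * beta δ r ^ 2 + δ * (1 + beta δ r ^ 2) := by
  have e : betaOne r = δ * beta δ r := by rw [beta]; field_simp
  have h0 : 0 ≤ δ * (1 + beta δ r ^ 2) := by positivity
  have h1 : 0 ≤ 4 * δ ^ 2 * beta δ r ^ 2 := by positivity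
  rcases le_or_gt 0 r with h | h
  · rw [max_eq_right (by linarith)]
    nlinarith
  rw [max_eq_left (by linarith)]
  rcases le_or_gt (-(1 / 2)) r with h2 | h2
  · have h3 : betaOne r = -r ^ 2 := by rw [betaOne, if_neg (by linarith), if_pos h2]
    -- On the quadratic piece `r² = -δ β_δ(r)`. On the linear piece below, `|r| ≤ 2|r + 1/4|`, that
    -- is, `|r| ≤ 2δ|β_δ(r)|`.
    have h4 : -(beta δ r) ≤ 1 + beta δ r ^ 2 := by nlinarith [sq_nonneg (beta δ r + 1)]
    have h5 := mul_le_mul_of_nonneg_left h4 hδ.le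
    nlinarith
  · have h3 : betaOne r = r + 1 / 4 := by rw [betaOne, if_neg (by linarith), if_neg (by linarith)]
    have h4 : (-r) ^ 2 ≤ (2 * betaOne r) ^ 2 := by rw [h3]; nlinarith
    rw [e] at h4
    nlinarith

lemma coeFn_betaL2 (δ : ℝ) (u : L2 Ω) :
    betaL2 δ u =ᵐ[volume.restrict Ω] fun x => beta δ (u x) :=
  (beta_lipschitz δ).coeFn_compLp (beta_zero δ) u

lemma norm_betaL2_sub_le {δ : ℝ} (hδ : 0 < δ) (u v : L2 Ω) :
    ‖betaL2 δ u - betaL2 δ v‖ ≤ 1 / δ * ‖u - v‖ := by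
  have := (beta_lipschitz δ).norm_compLp_sub_le (beta_zero δ) u v
  rwa [coe_nnnorm, Real.norm_of_nonneg (by positivity)] at this

lemma inner_nonneg_of_ae {u v : L2 Ω} (h : ∀ᵐ x ∂(volume.restrict Ω), 0 ≤ u x * v x) :
    0 ≤ inner ℝ u v := by
  rw [inner_eq_integral]
  exact integral_nonneg_of_ae h

lemma inner_betaL2_self_nonneg {δ : ℝ} (hδ : 0 < δ) (u : L2 Ω) : 0 ≤ inner ℝ (betaL2 δ u) u := by
  refine inner_nonneg_of_ae ?_
  filter_upwards [coeFn_betaL2 δ u] with x hx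
  rw [hx]
  exact beta_mul_self_nonneg hδ _

lemma inner_betaL2_sub_nonneg {δ : ℝ} (hδ : 0 < δ) (u v : L2 Ω) :
    0 ≤ inner ℝ (betaL2 δ u - betaL2 δ v) (u - v) := by
  refine inner_nonneg_of_ae ?_
  filter_upwards [coeFn_betaL2 δ u, coeFn_betaL2 δ v, Lp.coeFn_sub u v,
    Lp.coeFn_sub (betaL2 δ u) (betaL2 δ v)] with x h1 h2 h3 h4
  rw [h3, h4, Pi.sub_apply, Pi.sub_apply, h1, h2]
  rcases le_total (u x) (v x) with h | h
  · exact mul_nonneg_of_nonpos_of_nonpos (sub_nonpos.2 (beta_mono hδ h)) (sub_nonpos.2 h)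
  · exact mul_nonneg (sub_nonneg.2 (beta_mono hδ h)) (sub_nonneg.2 h)

/-! ### The penalized equation -/

lemma solvesDirichlet_iff {c : Coeffs n} {u g f : L2 Ω} :
    SolvesDirichlet c u g f ↔
      MemH10 u ∧ ∀ v : L2 Ω, MemH10 v → c.form u v + inner ℝ g v = inner ℝ f v := by
  simp only [inner_eq_integral]
  rfl

/-- The jet whose only nonzero entry is the function itself. -/
def zerothJet (u : L2 Ω) : Jet Ω := WithLp.toLp 2 fun o => o.elim u fun _ => 0

lemma inner_zerothJet (u : L2 Ω) (V : Jet Ω) : inner ℝ (zerothJet u) V = inner ℝ u (V none) := by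
  rw [PiLp.inner_apply, Fintype.sum_option]
  simp [zerothJet]

lemma zerothJet_sub (u v : L2 Ω) : zerothJet (u - v) = zerothJet u - zerothJet v := by
  ext o : 1
  cases o with
  | none => rfl
  | some i => simp [zerothJet]

lemma norm_zerothJet (u : L2 Ω) : ‖zerothJet u‖ = ‖u‖ := by
  rw [PiLp.norm_eq_of_L2, Fintype.sum_option]
  simp [zerothJet]

/-- Projected to `H¹₀`, the penalized operator is strongly monotone, by coercivity and monotonicity
of `β_δ`, and Lipschitz with constant `‖A‖ + 1 / δ`; Zarantonello's theorem applies. Existence is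
all that the choice made in `Tpen` requires. -/
lemma Coeffs.IsCoercive.exists_solvesDirichlet (hΩ : IsOpen Ω) {c : Coeffs n} (hc : c.Admissible Ω)
    (hcoer : c.IsCoercive Ω) (f φ : L2 Ω) {δ : ℝ} (hδ : 0 < δ) :
    ∃ y : L2 Ω, SolvesDirichlet c y (betaL2 δ (y - φ)) f := by
  obtain ⟨A, hA⟩ := hc.exists_operator
  obtain ⟨m, hm, hcoer⟩ := hcoer
  let R : Jet Ω → Jet Ω := fun U => A U + zerothJet (betaL2 δ (U none - φ) - f)
  have hR : ∀ U V : Jet Ω, R U - R V =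
      A (U - V) + zerothJet (betaL2 δ (U none - φ) - betaL2 δ (V none - φ)) := by
    intro U V
    simp only [R]
    rw [map_sub, zerothJet_sub, zerothJet_sub, zerothJet_sub]
    abel
  let P := (h10 hΩ).orthogonalProjectionOnto
  have hP : ∀ (U : Jet Ω) (V : h10 hΩ), inner ℝ (P U) V = inner ℝ U (V : Jet Ω) := fun U V =>
    Submodule.inner_orthogonalProjectionOnto_eq_of_mem_right V U
  obtain ⟨U, hU⟩ := exists_zero_of_strongly_monotone (fun U : h10 hΩ => P (R U)) (m := m)
    (L := ‖A‖ + 1 / δ) hm (fun U V => by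
      rw [← map_sub, hP, hR, inner_add_left, inner_zerothJet]
      have h1 := inner_betaL2_sub_nonneg hδ ((U : Jet Ω) none - φ) ((V : Jet Ω) none - φ)
      rw [sub_sub_sub_cancel_right] at h1
      have h2 := hcoer _ (memH10_of_mem_h10 (U - V))
      rw [hA, ← norm_jet, jet_of_mem_h10 (U - V)] at h2
      refine h2.trans ?_
      exact le_add_of_nonneg_right h1) (fun U V => by
      rw [← map_sub, hR]
      refine ((h10 hΩ).norm_orthogonalProjectionOnto_apply_le _).trans ((norm_add_le _ _).trans ?_)
      rw [norm_zerothJet, add_mul]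
      refine add_le_add (A.le_opNorm _) ((norm_betaL2_sub_le hδ _ _).trans ?_)
      rw [sub_sub_sub_cancel_right]
      refine mul_le_mul_of_nonneg_left ?_ (by positivity)
      exact PiLp.norm_apply_le ((U : Jet Ω) - (V : Jet Ω)) none)
  refine ⟨(U : Jet Ω) none, solvesDirichlet_iff.2 ⟨memH10_of_mem_h10 U, fun v hv => ?_⟩⟩
  have h1 := hP (R U) ⟨jet v, v, hv, rfl⟩
  rw [hU, inner_zero_left] at h1
  simp only [R] at h1
  rw [inner_add_left, inner_zerothJet, jet_none, inner_sub_left] at h1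
  rw [hA, jet_of_mem_h10 U]
  linarith

lemma Coeffs.IsCoercive.solvesDirichlet_Tpen (hΩ : IsOpen Ω) {c : Coeffs n} (hc : c.Admissible Ω)
    (hcoer : c.IsCoercive Ω) (f φ : L2 Ω) {δ : ℝ} (hδ : 0 < δ) :
    SolvesDirichlet c (Tpen c f δ φ) (penalty c f δ φ) f :=
  Classical.epsilon_spec (hcoer.exists_solvesDirichlet hΩ hc f φ hδ)

/-- The energy bound for the penalized equation, uniform in the penalization parameter. -/
lemma exists_normH1_Tpen_sub_le (hΩ : IsOpen Ω) {c : Coeffs n} (hc : c.Admissible Ω)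
    (hcoer : c.IsCoercive Ω) (f : L2 Ω) :
    ∃ C : ℝ, 0 ≤ C ∧ ∀ δ > 0, ∀ φ : L2 Ω, MemU φ →
      normH1 (Tpen c f δ φ - φ) ≤ C * (1 + normH2 φ) := by
  obtain ⟨M, hM, hMf⟩ := hc.exists_form_le
  obtain ⟨m, hm, hm'⟩ := hcoer
  refine ⟨(‖f‖ + M) / m, by positivity, fun δ hδ φ hφ => ?_⟩
  have hy := solvesDirichlet_iff.1
    (Coeffs.IsCoercive.solvesDirichlet_Tpen hΩ hc ⟨m, hm, hm'⟩ f φ hδ)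
  set y := Tpen c f δ φ with hydef
  -- This test function gives the penalty term a favourable sign, `β_δ(w) w ≥ 0`, so `δ` drops out
  -- of the estimate.
  have hw : MemH10 (y - φ) := hy.1.sub hΩ hφ.2
  have h1 := hm' _ hw
  rw [hc.form_sub_left hΩ hy.1.1 hφ.2.1] at h1
  have h2 := hy.2 _ hw
  have h3 : 0 ≤ inner ℝ (penalty c f δ φ) (y - φ) := inner_betaL2_self_nonneg hδ _
  have h4 := (abs_le.1 (abs_real_inner_le_norm f (y - φ))).2
  have h5 := (abs_le.1 (hMf φ (y - φ))).1
  have h6 : ‖f‖ * ‖y - φ‖ ≤ ‖f‖ * normH1 (y - φ) := by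
    gcongr
    exact norm_le_normH1 _
  have h7 : M * normH1 φ * normH1 (y - φ) ≤ M * normH2 φ * normH1 (y - φ) := by
    have := normH1_nonneg (y - φ)
    gcongr
    exact normH1_le_normH2 φ
  have h8 : m * normH1 (y - φ) ^ 2 ≤ (‖f‖ + M * normH2 φ) * normH1 (y - φ) := by
    rw [add_mul]; linarith
  have h9 : m * normH1 (y - φ) ≤ ‖f‖ + M * normH2 φ := by
    rcases (normH1_nonneg (y - φ)).eq_or_lt with h | h
    · rw [← h, mul_zero]
      have := normH2_nonneg φ
      positivity
    · refine le_of_mul_le_mul_right ?_ h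
      linarith
  rw [div_mul_eq_mul_div, le_div_iff₀ hm, mul_comm]
  refine h9.trans ?_
  have := mul_nonneg (norm_nonneg f) (normH2_nonneg φ)
  nlinarith

/-- Smooth increasing approximations of the penalization function. -/
lemma exists_smooth_beta {δ ε : ℝ} (hδ : 0 < δ) (hε : 0 < ε) :
    ∃ G : ℝ → ℝ, ContDiff ℝ ∞ G ∧ G 0 = 0 ∧ Monotone G ∧ (∀ r, |G r - beta δ r| ≤ ε) ∧
      (∀ r, |G r| ≤ 1 / δ * |r|) ∧ ∀ r, |deriv G r| ≤ 1 / δ := by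
  -- Accuracy `ε / 2`, since subtracting `G 0` to restore the value at `0` doubles the error.
  obtain ⟨G, hG, hGb, hGd⟩ := exists_smooth_approx (beta_lipschitz δ) (half_pos hε)
  have hl : LipschitzWith ‖1 / δ‖₊ G := by
    refine LipschitzWith.of_le_add_mul _ fun x y => ?_
    have := hGd (x - y) (‖1 / δ‖₊ * ‖x - y‖) (fun z => by
      have := (le_abs_self _).trans ((beta_lipschitz δ).dist_le_mul (z + (x - y)) z)
      simpa using this) y
    rw [add_sub_cancel] at this
    rw [dist_eq_norm]
    linarith
  have hn : ((‖1 / δ‖₊ : NNReal) : ℝ) = 1 / δ := by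
    rw [coe_nnnorm, Real.norm_of_nonneg (by positivity)]
  refine ⟨fun r => G r - G 0, hG.sub contDiff_const, sub_self _, ?_, fun r => ?_, fun r => ?_,
    fun r => ?_⟩
  · intro r s hrs
    have := hGd (r - s) 0 (fun z => sub_nonpos.2 (beta_mono hδ (by linarith))) s
    rw [add_sub_cancel] at this
    simp only
    linarith
  · have h1 := abs_le.1 (hGb r)
    have h2 := abs_le.1 (hGb 0)
    rw [beta_zero] at h2
    rw [abs_le]
    constructor <;> linarith [h1.1, h1.2, h2.1, h2.2]
  · have := hl.dist_le_mul r 0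
    rwa [hn, Real.dist_eq, Real.dist_eq, sub_zero] at this
  · rw [deriv_sub_const, ← hn]
    exact norm_deriv_le_of_lipschitz hl

/-- The constant may be as large as `1 / δ`: in the penalty estimate this bound only multiplies an
approximation error that vanishes for fixed `δ`. -/
lemma IsTestFunction.normH1_comp_le (hΩ : IsOpen Ω) {ψ : E n → ℝ} (hψ : IsTestFunction Ω ψ)
    {G : ℝ → ℝ} (hG : ContDiff ℝ ∞ G) (hG0 : G 0 = 0) {L : ℝ} (hL : 0 ≤ L)
    (hGL : ∀ r, |G r| ≤ L * |r|) (hGd : ∀ r, |deriv G r| ≤ L) :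
    normH1 (hψ.comp hG hG0).toL2 ≤ L * normH1 hψ.toL2 := by
  have h0 : ‖(hψ.comp hG hG0).toL2‖ ≤ L * ‖hψ.toL2‖ := by
    refine Lp.norm_le_mul_norm_of_ae_le_mul ?_
    filter_upwards [hψ.coeFn_toL2, (hψ.comp hG hG0).coeFn_toL2] with x h1 h2
    rw [h1, h2]
    exact hGL _
  have h1 : ∀ i, ‖pd i (hψ.comp hG hG0).toL2‖ ≤ L * ‖pd i hψ.toL2‖ := by
    intro i
    rw [pd_toL2 hΩ, pd_toL2 hΩ]
    refine Lp.norm_le_mul_norm_of_ae_le_mul ?_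
    filter_upwards [(hψ.partialDeriv i).coeFn_toL2,
      ((hψ.comp hG hG0).partialDeriv i).coeFn_toL2] with x h1 h2
    rw [h1, h2, hψ.partialDeriv_comp hG, norm_mul]
    exact mul_le_mul_of_nonneg_right (hGd _) (norm_nonneg _)
  rw [normH1, normH1, ← Real.sqrt_sq hL, ← Real.sqrt_mul (sq_nonneg L)]
  refine Real.sqrt_le_sqrt ?_
  rw [mul_add, Finset.mul_sum, ← mul_pow]
  refine add_le_add (pow_le_pow_left₀ (norm_nonneg _) h0 2) (Finset.sum_le_sum fun i _ => ?_)
  rw [← mul_pow]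
  exact pow_le_pow_left₀ (norm_nonneg _) (h1 i) 2

/-- The bound on the penalty term, uniform in the penalization parameter. -/
theorem exists_norm_penalty_le (hΩ : IsOpen Ω) (hb : Bornology.IsBounded Ω) {c : Coeffs n}
    (hc : c.Admissible Ω) (hcoer : c.IsCoercive Ω) (f : L2 Ω) :
    ∃ C : ℝ, 0 ≤ C ∧ ∀ δ > 0, ∀ φ : L2 Ω, MemU φ →
      ‖penalty c f δ φ‖ ≤ C * (1 + normH2 φ) := by
  have : IsFiniteMeasure (volume.restrict Ω) := ⟨by simpa using hb.measure_lt_top⟩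
  obtain ⟨C0, hC0, hw0⟩ := exists_normH1_Tpen_sub_le hΩ hc hcoer f
  obtain ⟨A, hA, hAf⟩ := hc.exists_form_le
  obtain ⟨C1, hC1, hC1'⟩ := hc.exists_form_le_normH2 hΩ hb
  obtain ⟨C2, hC2, hC2'⟩ := hc.exists_form_comp_ge hΩ
  refine ⟨‖f‖ + C1 + C2 * C0, by positivity, fun δ hδ φ hφ => ?_⟩
  have hy := solvesDirichlet_iff.1 (hcoer.solvesDirichlet_Tpen hΩ hc f φ hδ)
  set y := Tpen c f δ φ with hydef
  set ξ := penalty c f δ φ with hξdef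
  have hw : MemH10 (y - φ) := hy.1.sub hΩ hφ.2
  set w := y - φ with hwdef
  have hε : ∀ k : ℕ, (0 : ℝ) < 1 / (k + 1) := fun k => Nat.one_div_pos_of_nat
  have hεlim : Tendsto (fun k : ℕ => (1 : ℝ) / (k + 1)) atTop (𝓝 0) :=
    tendsto_one_div_add_atTop_nhds_zero_nat
  choose ψ hψ hψd using fun k : ℕ => hw.exists_test (hε k)
  choose G hG hG0 hGm hGb hGL hGd using fun k : ℕ => exists_smooth_beta hδ (hε k)
  set η : ℕ → L2 Ω := fun k => ((hψ k).comp (hG k) (hG0 k)).toL2 with hη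
  have hψlim : Tendsto (fun k => (hψ k).toL2) atTop (𝓝 w) := by
    rw [tendsto_iff_norm_sub_tendsto_zero]
    refine squeeze_zero (fun _ => norm_nonneg _) (fun k => ?_) hεlim
    rw [norm_sub_rev]
    exact (norm_le_normH1 _).trans (hψd k).le
  have hψH1 : Tendsto (fun k => normH1 (hψ k).toL2) atTop (𝓝 (normH1 w)) := by
    rw [tendsto_iff_norm_sub_tendsto_zero]
    refine squeeze_zero (fun _ => norm_nonneg _) (fun k => ?_) hεlim
    rw [← norm_jet, ← norm_jet]
    refine (abs_norm_sub_norm_le _ _).trans ?_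
    rw [norm_sub_rev, ← jet_sub hΩ hw.1 (hψ k).memH1, norm_jet]
    exact (hψd k).le
  have hηlim : Tendsto η atTop (𝓝 ξ) := by
    have h1 : Tendsto (fun k => betaL2 δ (hψ k).toL2) atTop (𝓝 ξ) := by
      rw [tendsto_iff_norm_sub_tendsto_zero]
      refine squeeze_zero (fun _ => norm_nonneg _) (fun k => norm_betaL2_sub_le hδ _ _) ?_
      simpa using (tendsto_iff_norm_sub_tendsto_zero.1 hψlim).const_mul (1 / δ)
    have h2 : Tendsto (fun k => η k - betaL2 δ (hψ k).toL2) atTop (𝓝 0) := by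
      refine squeeze_zero_norm (a := fun k : ℕ =>
        measureUnivNNReal (volume.restrict Ω) ^ (ENNReal.toReal 2)⁻¹ * (1 / ((k : ℝ) + 1)))
        (fun k => ?_) ?_
      · refine Lp.norm_le_of_ae_bound (hε k).le ?_
        filter_upwards [Lp.coeFn_sub (η k) (betaL2 δ (hψ k).toL2),
          ((hψ k).comp (hG k) (hG0 k)).coeFn_toL2, (hψ k).coeFn_toL2,
          coeFn_betaL2 δ (hψ k).toL2] with x e1 e2 e3 e4
        rw [e1, Pi.sub_apply, e2, e4, e3]
        exact hGb k _
      · simpa using hεlim.const_mul _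
    simpa using h2.add h1
  -- The equation tested with `η k`, a smooth version of `β_δ(w)`, after the splitting `y = φ + (w -
  -- ψ k) + ψ k`. The last summand has `η k` as a monotone function of itself.
  have hkey : ∀ k, inner ℝ ξ (η k) ≤
      (‖f‖ + C1 * normH2 φ + C2 * normH1 (hψ k).toL2) * ‖η k‖
        + A * (1 / (k + 1)) * (1 / δ * normH1 (hψ k).toL2) := by
    intro k
    have hηt := (hψ k).comp (hG k) (hG0 k)
    have e1 := hy.2 _ (hηt.memH10 hΩ)
    have e2 : c.form y (η k) = c.form φ (η k) + c.form (w - (hψ k).toL2) (η k)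
        + c.form (hψ k).toL2 (η k) := by
      rw [hc.form_sub_left hΩ hw.1 (hψ k).memH1, hwdef, hc.form_sub_left hΩ hy.1.1 hφ.2.1]
      ring
    have b1 := (abs_le.1 (hC1' φ hφ.1 _ hηt)).1
    have b2 := hC2' _ (hψ k) _ (hG k) (hG0 k) (hGm k)
    have b3 := (abs_le.1 (hAf (w - (hψ k).toL2) (η k))).1
    have b4 := (abs_le.1 (abs_real_inner_le_norm f (η k))).2
    -- The factor `1 / δ` is harmless: `δ` is fixed while `k` tends to infinity.
    have b5 : A * normH1 (w - (hψ k).toL2) * normH1 (η k) ≤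
        A * (1 / (k + 1)) * (1 / δ * normH1 (hψ k).toL2) := by
      have := normH1_nonneg (η k)
      gcongr
      · exact (hψd k).le
      · exact (hψ k).normH1_comp_le hΩ (hG k) (hG0 k) (by positivity) (hGL k) (hGd k)
    change c.form y (η k) + inner ℝ ξ (η k) = inner ℝ f (η k) at e1
    change -(C1 * normH2 φ * ‖η k‖) ≤ c.form φ (η k) at b1
    change -(C2 * normH1 (hψ k).toL2 * ‖η k‖) ≤ c.form (hψ k).toL2 (η k) at b2
    rw [add_mul, add_mul]
    linarith
  have hlim : inner ℝ ξ ξ ≤ (‖f‖ + C1 * normH2 φ + C2 * normH1 w) * ‖ξ‖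
      + A * 0 * (1 / δ * normH1 w) := by
    refine le_of_tendsto_of_tendsto' (tendsto_const_nhds.inner hηlim) ?_ hkey
    exact ((tendsto_const_nhds.add (hψH1.const_mul _)).mul hηlim.norm).add
      ((hεlim.const_mul A).mul (hψH1.const_mul _))
  have h1 : ‖ξ‖ ≤ ‖f‖ + C1 * normH2 φ + C2 * normH1 w := by
    rw [mul_zero, zero_mul, add_zero, real_inner_self_eq_norm_sq] at hlim
    rcases (norm_nonneg ξ).eq_or_lt with h | h
    · rw [← h]
      have := normH2_nonneg φ
      have := normH1_nonneg w
      positivity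
    · refine le_of_mul_le_mul_right ?_ h
      linarith
  have h2 := mul_le_mul_of_nonneg_left (hw0 δ hδ φ hφ) hC2
  have h3 := mul_nonneg (norm_nonneg f) (normH2_nonneg φ)
  change C2 * normH1 w ≤ _ at h2
  linarith

/-! ### Passage to the limit in the penalized equation -/

/-- A bounded penalty term thus forces the violation of the constraint `y ≥ φ` to vanish in `L²` as
`δ → 0`. -/
lemma norm_negPart_sq_le [IsFiniteMeasure (volume.restrict Ω)] {δ : ℝ} (hδ : 0 < δ) (w : L2 Ω) :
    ‖Lp.negPart w‖ ^ 2 ≤ 4 * δ ^ 2 * ‖betaL2 δ w‖ ^ 2 +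
      δ * ((volume.restrict Ω).real univ + ‖betaL2 δ w‖ ^ 2) := by
  simp only [← real_inner_self_eq_norm_sq, inner_eq_integral]
  have hint : Integrable (fun x => betaL2 δ w x * betaL2 δ w x) (volume.restrict Ω) :=
    L2.integrable_inner (𝕜 := ℝ) (betaL2 δ w) (betaL2 δ w)
  have hint' : Integrable (fun x => Lp.negPart w x * Lp.negPart w x) (volume.restrict Ω) :=
    L2.integrable_inner (𝕜 := ℝ) (Lp.negPart w) (Lp.negPart w)
  have e : 4 * δ ^ 2 * (∫ x in Ω, betaL2 δ w x * betaL2 δ w x) + δ *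
      ((volume.restrict Ω).real univ + ∫ x in Ω, betaL2 δ w x * betaL2 δ w x) =
      ∫ x in Ω, (4 * δ ^ 2 * (betaL2 δ w x * betaL2 δ w x) +
        δ * (1 + betaL2 δ w x * betaL2 δ w x)) := by
    have h1 : Integrable (fun x => 1 + betaL2 δ w x * betaL2 δ w x) (volume.restrict Ω) :=
      (integrable_const 1).add hint
    rw [integral_add (hint.const_mul _) (h1.const_mul _), integral_const_mul, integral_const_mul,
      integral_add (integrable_const 1) hint]
    simp
  rw [e]
  refine integral_mono_ae hint'
    ((hint.const_mul _).add (((integrable_const 1).add hint).const_mul _)) ?_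
  filter_upwards [coeFn_betaL2 δ w, Lp.coeFn_negPart_eq_max w] with x h1 h2
  simp only [h1, h2, ← sq]
  exact negPart_sq_le hδ (w x)

/-- Where `v ≥ 0` the integrand `ξ v` is nonpositive, so only the negative part of `v` contributes.
This handles the cross terms in the Cauchy argument. -/
lemma inner_le_norm_mul_norm_negPart {ξ : L2 Ω} (hξ : ∀ᵐ x ∂(volume.restrict Ω), ξ x ≤ 0)
    (v : L2 Ω) : inner ℝ ξ v ≤ ‖ξ‖ * ‖Lp.negPart v‖ := by
  have h1 : 0 ≤ inner ℝ (-ξ) (v + Lp.negPart v) := by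
    refine inner_nonneg_of_ae ?_
    filter_upwards [hξ, Lp.coeFn_neg ξ, Lp.coeFn_add v (Lp.negPart v),
      Lp.coeFn_negPart_eq_max v] with x h1 h2 h3 h4
    rw [h2, h3, Pi.neg_apply, Pi.add_apply, h4]
    refine mul_nonneg (by linarith) ?_
    linarith [le_max_left (-v x) 0]
  rw [inner_neg_left, inner_add_right] at h1
  linarith [(abs_le.1 (abs_real_inner_le_norm ξ (Lp.negPart v))).1]

lemma betaL2_nonpos {δ : ℝ} (hδ : 0 < δ) (u : L2 Ω) :
    ∀ᵐ x ∂(volume.restrict Ω), betaL2 δ u x ≤ 0 := by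
  filter_upwards [coeFn_betaL2 δ u] with x hx
  rw [hx]
  exact beta_nonpos hδ _

/-- Testing with the positive part of the limit gives `‖ξ₀⁺‖² ≤ 0`. -/
lemma nonpos_of_weakly_tendsto {ι : Type*} {l : Filter ι} [l.NeBot] {ξ : ι → L2 Ω} {ξ₀ : L2 Ω}
    (hξ : ∀ᶠ i in l, ∀ᵐ x ∂(volume.restrict Ω), ξ i x ≤ 0)
    (hw : ∀ w, Tendsto (fun i => inner ℝ (ξ i) w) l (𝓝 (inner ℝ ξ₀ w))) :
    ∀ᵐ x ∂(volume.restrict Ω), ξ₀ x ≤ 0 := by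
  have h1 : inner ℝ ξ₀ (Lp.posPart ξ₀) ≤ 0 := by
    refine le_of_tendsto (hw _) ?_
    filter_upwards [hξ] with i hi
    have : 0 ≤ inner ℝ (-ξ i) (Lp.posPart ξ₀) := by
      refine inner_nonneg_of_ae ?_
      filter_upwards [hi, Lp.coeFn_neg (ξ i), Lp.coeFn_posPart ξ₀] with x e1 e2 e3
      rw [e2, e3, Pi.neg_apply]
      exact mul_nonneg (by linarith) (le_max_right _ _)
    rw [inner_neg_left] at this
    linarith
  have h2 : inner ℝ ξ₀ (Lp.posPart ξ₀) = inner ℝ (Lp.posPart ξ₀) (Lp.posPart ξ₀) := by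
    rw [inner_eq_integral, inner_eq_integral]
    refine integral_congr_ae ?_
    filter_upwards [Lp.coeFn_posPart ξ₀] with x hx
    rw [hx]
    rcases le_total (ξ₀ x) 0 with h | h
    · rw [max_eq_right h]; simp
    · rw [max_eq_left h]
  rw [h2, real_inner_self_nonpos] at h1
  filter_upwards [Lp.coeFn_posPart ξ₀, Lp.coeFn_zero ℝ 2 (volume.restrict Ω)] with x e1 e2
  rw [h1, e2] at e1
  exact (le_max_left _ _).trans_eq e1.symm

/-- Each solution is admissible in the inequality of the other; adding the two gives `a(y - y', y -
y') ≤ 0`. -/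
lemma Coeffs.IsCoercive.solvesObstacle_unique (hΩ : IsOpen Ω) {c : Coeffs n} (hc : c.Admissible Ω)
    (hcoer : c.IsCoercive Ω) {f φ y y' : L2 Ω} (h : SolvesObstacle c f φ y)
    (h' : SolvesObstacle c f φ y') : y = y' := by
  obtain ⟨m, hm, hm'⟩ := hcoer
  have h1 := h.2 y' h'.1
  have h2 := h'.2 y h.1
  rw [← inner_eq_integral] at h1 h2
  have hy := h.1.1.1
  have hy' := h'.1.1.1
  have h3 := hm' _ (h.1.1.sub hΩ h'.1.1)
  rw [hc.form_sub_left hΩ hy hy', hc.form_sub_right hΩ _ hy hy',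
    hc.form_sub_right hΩ _ hy hy'] at h3
  rw [hc.form_sub_right hΩ _ hy' hy, inner_sub_right] at h1
  rw [hc.form_sub_right hΩ _ hy hy', inner_sub_right] at h2
  have h4 : m * normH1 (y - y') ^ 2 ≤ 0 := by linarith
  have h5 : normH1 (y - y') = 0 := by
    by_contra hne
    have : 0 < normH1 (y - y') ^ 2 := by positivity
    nlinarith
  have h6 := norm_le_normH1 (y - y')
  rw [h5] at h6
  exact sub_eq_zero.1 (norm_le_zero_iff.1 h6)

lemma Coeffs.IsCoercive.T_eq (hΩ : IsOpen Ω) {c : Coeffs n} (hc : c.Admissible Ω)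
    (hcoer : c.IsCoercive Ω) {f φ y : L2 Ω} (h : SolvesObstacle c f φ y) : T c f φ = y :=
  hcoer.solvesObstacle_unique hΩ hc (Classical.epsilon_spec (p := SolvesObstacle c f φ) ⟨y, h⟩) h

/-- If the penalty terms stay bounded and the obstacles converge in `L²(Ω)`, then the solutions of
the penalized equations converge to the solution of the obstacle problem and the penalty terms
converge weakly to its multiplier. -/
theorem tendsto_Tpen (hΩ : IsOpen Ω) (hb : Bornology.IsBounded Ω) {c : Coeffs n}
    (hc : c.Admissible Ω) (hcoer : c.IsCoercive Ω) (f : L2 Ω) {ι : Type*} {l : Filter ι}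
    [l.IsCountablyGenerated] [l.NeBot] {d : ι → ℝ} (hd0 : ∀ᶠ i in l, 0 < d i)
    (hd : Tendsto d l (𝓝 0)) {φ : ι → L2 Ω} {φ₀ : L2 Ω} (hφ : Tendsto φ l (𝓝 φ₀)) {C : ℝ}
    (hC : ∀ᶠ i in l, ‖penalty c f (d i) (φ i)‖ ≤ C) :
    Tendsto (fun i => Tpen c f (d i) (φ i)) l (𝓝 (T c f φ₀)) ∧
      ∃ ξ₀ : L2 Ω, (∀ w, Tendsto (fun i => inner ℝ (penalty c f (d i) (φ i)) w) l
          (𝓝 (inner ℝ ξ₀ w))) ∧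
        (∀ᵐ x ∂(volume.restrict Ω), ξ₀ x ≤ 0) ∧ SolvesDirichlet c (T c f φ₀) ξ₀ f := by
  have : IsFiniteMeasure (volume.restrict Ω) := ⟨by simpa using hb.measure_lt_top⟩
  have hC0 : 0 ≤ C := by
    obtain ⟨i, hi⟩ := hC.exists
    exact (norm_nonneg _).trans hi
  obtain ⟨A, hA⟩ := hc.exists_operator
  obtain ⟨m, hm, hm'⟩ := id hcoer
  set y : ι → L2 Ω := fun i => Tpen c f (d i) (φ i) with hy
  set ξ : ι → L2 Ω := fun i => penalty c f (d i) (φ i) with hξ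
  set N : ι → L2 Ω := fun i => Lp.negPart (y i - φ i) with hN
  have heq : ∀ i, 0 < d i → SolvesDirichlet c (y i) (ξ i) f := fun i hi =>
    hcoer.solvesDirichlet_Tpen hΩ hc f (φ i) hi
  have hξneg : ∀ i, 0 < d i → ∀ᵐ x ∂(volume.restrict Ω), ξ i x ≤ 0 := fun i hi =>
    betaL2_nonpos hi _
  have hξw : ∀ i, 0 < d i → 0 ≤ inner ℝ (ξ i) (y i - φ i) := fun i hi =>
    inner_betaL2_self_nonneg hi _
  have hNlim : Tendsto (fun i => ‖N i‖) l (𝓝 0) := by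
    have h1 : Tendsto (fun i => 4 * d i ^ 2 * C ^ 2 +
        d i * ((volume.restrict Ω).real univ + C ^ 2)) l (𝓝 0) := by
      simpa using (((hd.pow 2).const_mul 4).mul_const (C ^ 2)).add
        (hd.mul_const ((volume.restrict Ω).real univ + C ^ 2))
    have h2 : Tendsto (fun i => ‖N i‖ ^ 2) l (𝓝 0) := by
      refine squeeze_zero' (Eventually.of_forall fun _ => by positivity) ?_ h1
      filter_upwards [hd0, hC] with i hi hi'
      refine (norm_negPart_sq_le hi (y i - φ i)).trans ?_
      have : ‖betaL2 (d i) (y i - φ i)‖ ≤ C := hi'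
      gcongr
    simpa using h2.sqrt
  have hCauchy : Cauchy (map (fun i => jet (y i)) l) := by
    rw [Metric.cauchy_iff]
    refine ⟨inferInstance, fun ε hε => ?_⟩
    -- The two cross terms contribute `C * e` each and the two obstacle differences `2 * C * e`
    -- each, so `6 * C * e` in total.
    set e : ℝ := m * ε ^ 2 / (6 * (C + 1)) with he
    have he0 : 0 < e := by positivity
    have he1 : 6 * (C + 1) * e = m * ε ^ 2 := by rw [he]; field_simp
    have hgood := ((hd0.and hC).and (hNlim.eventually (gt_mem_nhds he0))).and
      ((tendsto_iff_norm_sub_tendsto_zero.1 hφ).eventually (gt_mem_nhds he0))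
    refine ⟨_, image_mem_map hgood, ?_⟩
    rintro _ ⟨i, ⟨⟨⟨hi, hiC⟩, hiN⟩, hiφ⟩, rfl⟩ _ ⟨j, ⟨⟨⟨hj, hjC⟩, hjN⟩, hjφ⟩, rfl⟩
    have hyi := solvesDirichlet_iff.1 (heq i hi)
    have hyj := solvesDirichlet_iff.1 (heq j hj)
    have hH := hyi.1.sub hΩ hyj.1
    have h1 := hm' _ hH
    have h2 := hyi.2 _ hH
    have h3 := hyj.2 _ hH
    rw [hc.form_sub_left hΩ hyi.1.1 hyj.1.1] at h1
    have h4 : inner ℝ (ξ i) (y i - y j) = inner ℝ (ξ i) (y i - φ i)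
        - inner ℝ (ξ i) (y j - φ j) + inner ℝ (ξ i) (φ i - φ j) := by
      rw [← inner_sub_right, ← inner_add_right]
      congr 1; abel
    have h5 : inner ℝ (ξ j) (y i - y j) = inner ℝ (ξ j) (y i - φ i)
        - inner ℝ (ξ j) (y j - φ j) + inner ℝ (ξ j) (φ i - φ j) := by
      rw [← inner_sub_right, ← inner_add_right]
      congr 1; abel
    have h6 := inner_le_norm_mul_norm_negPart (hξneg i hi) (y j - φ j)
    have h7 := inner_le_norm_mul_norm_negPart (hξneg j hj) (y i - φ i)
    have h8 : ‖ξ i‖ * ‖N j‖ ≤ C * e := mul_le_mul hiC hjN.le (norm_nonneg _) hC0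
    have h9 : ‖ξ j‖ * ‖N i‖ ≤ C * e := mul_le_mul hjC hiN.le (norm_nonneg _) hC0
    have hφij : ‖φ i - φ j‖ ≤ 2 * e := by
      have := norm_sub_le (φ i - φ₀) (φ j - φ₀)
      rw [sub_sub_sub_cancel_right] at this
      linarith
    have h10 := (abs_le.1 (abs_real_inner_le_norm (ξ i) (φ i - φ j))).1
    have h11 := (abs_le.1 (abs_real_inner_le_norm (ξ j) (φ i - φ j))).2
    have h12 : ‖ξ i‖ * ‖φ i - φ j‖ ≤ C * (2 * e) := mul_le_mul hiC hφij (norm_nonneg _) hC0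
    have h13 : ‖ξ j‖ * ‖φ i - φ j‖ ≤ C * (2 * e) := mul_le_mul hjC hφij (norm_nonneg _) hC0
    have h14 := hξw i hi
    have h15 := hξw j hj
    have h16 : m * normH1 (y i - y j) ^ 2 < m * ε ^ 2 := by
      change inner ℝ (ξ i) (y j - φ j) ≤ ‖ξ i‖ * ‖N j‖ at h6
      change inner ℝ (ξ j) (y i - φ i) ≤ ‖ξ j‖ * ‖N i‖ at h7
      linarith
    rw [dist_eq_norm, ← jet_sub hΩ hyi.1.1 hyj.1.1, norm_jet]
    exact lt_of_pow_lt_pow_left₀ 2 hε.le (lt_of_mul_lt_mul_left h16 hm.le)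
  obtain ⟨U, hU⟩ := cauchy_map_iff_exists_tendsto.1 hCauchy
  have hUmem : U ∈ h10 hΩ := by
    refine (isClosed_h10 hΩ).mem_of_tendsto hU ?_
    filter_upwards [hd0] with i hi
    exact ⟨_, (heq i hi).1, rfl⟩
  obtain ⟨y₀, hy₀, rfl⟩ := hUmem
  have hylim : Tendsto y l (𝓝 y₀) := ((PiLp.continuous_apply 2 _ none).tendsto _).comp hU
  have hform : ∀ v, Tendsto (fun i => c.form (y i) v) l (𝓝 (c.form y₀ v)) := by
    intro v
    simp only [hA]
    exact ((A.continuous.tendsto _).comp hU).inner tendsto_const_nhds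
  have hξform : ∀ v, MemH10 v →
      Tendsto (fun i => inner ℝ (ξ i) v) l (𝓝 (inner ℝ f v - c.form y₀ v)) := by
    intro v hv
    refine ((hform v).const_sub (inner ℝ f v)).congr' ?_
    filter_upwards [hd0] with i hi
    linarith [(solvesDirichlet_iff.1 (heq i hi)).2 v hv]
  -- The equation fixes the limit against test functions, which are dense in `L²`; with boundedness
  -- the whole family converges weakly.
  obtain ⟨ξ₀, hξ₀⟩ := exists_weak_limit ξ hC (dense_testSubmodule hΩ) (by
    rintro _ ⟨ψ, hψ, rfl⟩
    exact ⟨_, hξform _ (hψ.memH10 hΩ)⟩)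
  have hneg : ∀ᵐ x ∂(volume.restrict Ω), ξ₀ x ≤ 0 :=
    nonpos_of_weakly_tendsto (hd0.mono hξneg) hξ₀
  have hsol : SolvesDirichlet c y₀ ξ₀ f := by
    refine solvesDirichlet_iff.2 ⟨hy₀, fun v hv => ?_⟩
    have := tendsto_nhds_unique (hξ₀ v) (hξform v hv)
    linarith
  have hwlim : Tendsto (fun i => y i - φ i) l (𝓝 (y₀ - φ₀)) := hylim.sub hφ
  have hobs : ∀ᵐ x ∂(volume.restrict Ω), φ₀ x ≤ y₀ x := by
    have h1 : Tendsto (fun i => ‖N i‖) l (𝓝 ‖Lp.negPart (y₀ - φ₀)‖) :=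
      ((Lp.continuous_negPart.tendsto _).comp hwlim).norm
    have h2 : Lp.negPart (y₀ - φ₀) = 0 := norm_eq_zero.1 (tendsto_nhds_unique h1 hNlim)
    filter_upwards [Lp.coeFn_negPart_eq_max (y₀ - φ₀), Lp.coeFn_zero ℝ 2 (volume.restrict Ω),
      Lp.coeFn_sub y₀ φ₀] with x e1 e2 e3
    rw [h2, e2, e3, Pi.sub_apply] at e1
    have := le_max_left (-(y₀ x - φ₀ x)) 0
    rw [← e1, Pi.zero_apply] at this
    linarith
  -- Half of complementarity, from weak convergence of `ξ` against strong convergence of `y - φ`. It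
  -- suffices below: with `ξ₀ ≤ 0` it gives `(ξ₀, v - y₀) ≤ 0` for every admissible `v`.
  have hcompl : 0 ≤ inner ℝ ξ₀ (y₀ - φ₀) :=
    ge_of_tendsto (tendsto_inner_of_weakly_of_strongly hC hξ₀ hwlim) (hd0.mono hξw)
  have hT : T c f φ₀ = y₀ := by
    refine hcoer.T_eq hΩ hc ⟨⟨hy₀, hobs⟩, fun v hv => ?_⟩
    rw [← inner_eq_integral]
    have h1 := (solvesDirichlet_iff.1 hsol).2 _ (hv.1.sub hΩ hy₀)
    have h2 : 0 ≤ inner ℝ (-ξ₀) (v - φ₀) := by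
      refine inner_nonneg_of_ae ?_
      filter_upwards [hneg, hv.2, Lp.coeFn_neg ξ₀, Lp.coeFn_sub v φ₀] with x e1 e2 e3 e4
      rw [e3, e4, Pi.neg_apply, Pi.sub_apply]
      exact mul_nonneg (by linarith) (by linarith)
    have h3 : inner ℝ ξ₀ (v - y₀) = inner ℝ ξ₀ (v - φ₀) - inner ℝ ξ₀ (y₀ - φ₀) := by
      rw [← inner_sub_right, sub_sub_sub_cancel_right]
    rw [inner_neg_left] at h2
    linarith
  rw [hT]
  exact ⟨hylim, ξ₀, hξ₀, hneg, hsol⟩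

/-! ### Weak convergence in `H²` -/

/-- By the Riesz representation, convergence in the weak topology amounts to convergence of all
inner products. -/
lemma weaklyTendsto_iff {u : ℝ → L2 Ω} {u₀ : L2 Ω} :
    WeaklyTendsto u u₀ ↔
      ∀ w : L2 Ω, Tendsto (fun δ => inner ℝ (u δ) w) (𝓝[>] (0 : ℝ)) (𝓝 (inner ℝ u₀ w)) := by
  have hinj : Function.Injective (topDualPairing ℝ (L2 Ω)).flip := by
    intro x y hxy
    refine ext_inner_left ℝ fun w => ?_
    exact LinearMap.congr_fun hxy (innerSL ℝ w)
  have key : WeaklyTendsto u u₀ ↔ ∀ F : StrongDual ℝ (L2 Ω),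
      Tendsto (fun δ => F (u δ)) (𝓝[>] (0 : ℝ)) (𝓝 (F u₀)) :=
    WeakBilin.tendsto_iff_forall_eval_tendsto (topDualPairing ℝ (L2 Ω)).flip hinj
  rw [key]
  constructor
  · intro h w
    simp only [real_inner_comm w]
    exact h (innerSL ℝ w)
  · intro h F
    have := h ((InnerProductSpace.toDual ℝ (L2 Ω)).symm F)
    simpa only [real_inner_comm ((InnerProductSpace.toDual ℝ (L2 Ω)).symm F),
      InnerProductSpace.toDual_symm_apply] using this

/-- The filter is countably generated, so sequences suffice; `rellich` applies to the differences `u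
- u₀` after the finitely many bad indices are dropped. -/
lemma tendsto_of_weakly_tendsto_of_normH1_le (hΩ : IsOpen Ω) (hb : Bornology.IsBounded Ω)
    {ι : Type*} {l : Filter ι} [l.IsCountablyGenerated] {u : ι → L2 Ω} {u₀ : L2 Ω}
    (hu₀ : MemH10 u₀) (hu : ∀ᶠ i in l, MemH10 (u i)) {C : ℝ} (hC : ∀ᶠ i in l, normH1 (u i) ≤ C)
    (hw : ∀ w, Tendsto (fun i => inner ℝ (u i) w) l (𝓝 (inner ℝ u₀ w))) :
    Tendsto u l (𝓝 u₀) := by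
  refine tendsto_of_seq_tendsto fun s hs => ?_
  obtain ⟨N, hN⟩ := eventually_atTop.1 (hs.eventually (hu.and hC))
  rw [← tendsto_add_atTop_iff_nat N]
  have h1 : Tendsto (fun k => u (s (k + N)) - u₀) atTop (𝓝 0) := by
    refine rellich hΩ hb (C := C + normH1 u₀) (fun k => (hN _ (by omega)).1.sub hΩ hu₀)
      (fun k => ?_) fun w => ?_
    · have hk := hN (k + N) (by omega)
      rw [← norm_jet, jet_sub hΩ hk.1.1 hu₀.1]
      refine (norm_sub_le _ _).trans ?_
      rw [norm_jet, norm_jet]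
      linarith [hk.2]
    · have h2 := ((hw w).comp (hs.comp (tendsto_add_atTop_nat N))).sub_const (inner ℝ u₀ w)
      rw [sub_self] at h2
      refine h2.congr fun k => ?_
      rw [inner_sub_left]
      rfl
  exact tendsto_sub_nhds_zero_iff.1 h1

/-- The ambient Hilbert space of a function and its derivatives of order at most two. -/
abbrev Jet2 (Ω : Set (E n)) : Type :=
  PiLp 2 (fun _ : Option (Fin n) ⊕ Fin n × Fin n => L2 Ω)

/-- A function together with its weak derivatives of order at most two. -/
def jet2 (u : L2 Ω) : Jet2 Ω :=
  WithLp.toLp 2 (Sum.elim (fun o => o.elim u fun i => pd i u) fun p => pd p.1 (pd p.2 u))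

lemma jet2_inr (u : L2 Ω) (p : Fin n × Fin n) : jet2 u (Sum.inr p) = pd p.1 (pd p.2 u) := rfl

lemma norm_jet2 (u : L2 Ω) : ‖jet2 u‖ = normH2 u := by
  rw [PiLp.norm_eq_of_L2, normH2, Fintype.sum_sum_type, Fintype.sum_option, Fintype.sum_prod_type]
  rfl

lemma MemH2.add (hΩ : IsOpen Ω) {u v : L2 Ω} (hu : MemH2 u) (hv : MemH2 v) : MemH2 (u + v) := by
  refine ⟨hu.1.add hv.1, fun i => ?_⟩
  rw [pd_add hΩ hu.1 hv.1]
  exact (hu.2 i).add (hv.2 i)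

lemma MemH2.smul (hΩ : IsOpen Ω) {u : L2 Ω} (hu : MemH2 u) (a : ℝ) : MemH2 (a • u) := by
  refine ⟨hu.1.smul a, fun i => ?_⟩
  rw [pd_smul hΩ hu.1]
  exact (hu.2 i).smul a

lemma jet2_add (hΩ : IsOpen Ω) {u v : L2 Ω} (hu : MemH2 u) (hv : MemH2 v) :
    jet2 (u + v) = jet2 u + jet2 v := by
  ext o : 1
  rcases o with o | ⟨i, j⟩
  · exact congrArg (fun U : Jet Ω => U o) (jet_add hΩ hu.1 hv.1)
  · rw [PiLp.add_apply, jet2_inr, jet2_inr, jet2_inr, pd_add hΩ hu.1 hv.1,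
      pd_add hΩ (hu.2 _) (hv.2 _)]

lemma jet2_smul (hΩ : IsOpen Ω) {u : L2 Ω} (hu : MemH2 u) (a : ℝ) :
    jet2 (a • u) = a • jet2 u := by
  ext o : 1
  rcases o with o | ⟨i, j⟩
  · exact congrArg (fun U : Jet Ω => U o) (jet_smul hΩ hu.1 a)
  · rw [PiLp.smul_apply, jet2_inr, jet2_inr, pd_smul hΩ hu.1, pd_smul hΩ (hu.2 _)]

lemma jet2_sub (hΩ : IsOpen Ω) {u v : L2 Ω} (hu : MemH2 u) (hv : MemH2 v) :
    jet2 (u - v) = jet2 u - jet2 v := by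
  rw [sub_eq_add_neg, ← neg_one_smul ℝ v, jet2_add hΩ hu (hv.smul hΩ _), jet2_smul hΩ hv,
    neg_one_smul, sub_eq_add_neg]

/-- The jets of a closed convex subset of `𝒰` form a closed convex set. -/
lemma IsClosedConvexInU.isClosed_image_jet2 (hΩ : IsOpen Ω) {S : Set (L2 Ω)}
    (hS : IsClosedConvexInU S) : IsClosed (jet2 '' S) := by
  refine isClosed_of_closure_subset fun Φ hΦ => ?_
  obtain ⟨V, hV, hlim⟩ := mem_closure_iff_seq_limit.1 hΦ
  choose v hv hVv using hV
  obtain rfl : (fun k => jet2 (v k)) = V := funext hVv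
  have hU : ∀ k, MemU (v k) := fun k => hS.1 _ (hv k)
  have hcoord : ∀ o, Tendsto (fun k => jet2 (v k) o) atTop (𝓝 (Φ o)) := fun o =>
    ((PiLp.continuous_apply 2 _ o).tendsto Φ).comp hlim
  set u : L2 Ω := Φ (Sum.inl none) with hu
  have h1 : ∀ i, IsWeakPartial i u (Φ (Sum.inl (some i))) := fun i =>
    IsWeakPartial.of_tendsto (fun k => (hU k).1.1.isWeakPartial i) (hcoord (Sum.inl none))
      (hcoord (Sum.inl (some i)))
  have h2 : ∀ i j, IsWeakPartial i (Φ (Sum.inl (some j))) (Φ (Sum.inr (i, j))) := fun i j =>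
    IsWeakPartial.of_tendsto (fun k => ((hU k).1.2 j).isWeakPartial i)
      (hcoord (Sum.inl (some j))) (hcoord (Sum.inr (i, j)))
  have h3 : ∀ i, pd i u = Φ (Sum.inl (some i)) := fun i => (h1 i).pd_eq hΩ
  have hH2 : MemH2 u := by
    refine ⟨fun i => ⟨_, h1 i⟩, fun i j => ?_⟩
    rw [h3]
    exact ⟨_, h2 j i⟩
  have hΦu : Φ = jet2 u := by
    ext o : 1
    rcases o with (_ | i) | ⟨i, j⟩
    · rfl
    · exact (h3 i).symm
    · rw [jet2_inr, h3]
      exact ((h2 i j).pd_eq hΩ).symm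
  have hnorm : Tendsto (fun k => normH2 (v k - u)) atTop (𝓝 0) := by
    refine (tendsto_iff_norm_sub_tendsto_zero.1 hlim).congr fun k => ?_
    rw [hΦu, ← jet2_sub hΩ (hU k).1 hH2, norm_jet2]
  have hH10 : MemH10 u := by
    have hjet : Tendsto (fun k => jet (v k)) atTop (𝓝 (jet u)) := by
      rw [tendsto_iff_norm_sub_tendsto_zero]
      refine squeeze_zero (fun _ => norm_nonneg _) (fun k => ?_) hnorm
      rw [← jet_sub hΩ (hU k).1.1 hH2.1, norm_jet]
      exact normH1_le_normH2 _
    have hmem : jet u ∈ h10 hΩ :=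
      (isClosed_h10 hΩ).mem_of_tendsto hjet (Eventually.of_forall fun k => ⟨_, (hU k).2, rfl⟩)
    exact memH10_of_mem_h10 ⟨_, hmem⟩
  exact ⟨u, hS.2.2 v u hv ⟨hH2, hH10⟩ hnorm, hΦu.symm⟩

lemma IsClosedConvexInU.convex_image_jet2 (hΩ : IsOpen Ω) {S : Set (L2 Ω)}
    (hS : IsClosedConvexInU S) : Convex ℝ (jet2 '' S) := by
  rintro _ ⟨u, hu, rfl⟩ _ ⟨v, hv, rfl⟩ a b ha hb hab
  have hu' := (hS.1 u hu).1
  have hv' := (hS.1 v hv).1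
  refine ⟨a • u + b • v, hS.2.1 hu hv ha hb hab, ?_⟩
  rw [jet2_add hΩ (hu'.smul hΩ a) (hv'.smul hΩ b), jet2_smul hΩ hu', jet2_smul hΩ hv']

lemma inner_toLp_single {κ : Type*} [Fintype κ] [DecidableEq κ]
    (U : PiLp 2 (fun _ : κ => L2 Ω)) (o : κ) (w : L2 Ω) :
    inner ℝ U (WithLp.toLp 2 (Pi.single o w)) = inner ℝ (U o) w := by
  rw [PiLp.inner_apply, Finset.sum_eq_single o]
  · simp
  · intro o' _ ho'
    simp [ho']
  · simp

/-- Sequences in a closed convex subset of `𝒰` bounded in `H²` have subsequences converging weakly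
in `H²` to an element of this subset. -/
lemma IsClosedConvexInU.exists_subseq (hΩ : IsOpen Ω) {S : Set (L2 Ω)} (hS : IsClosedConvexInU S)
    {u : ℕ → L2 Ω} (hu : ∀ k, u k ∈ S) {C : ℝ} (hC : ∀ k, normH2 (u k) ≤ C) :
    ∃ v ∈ S, ∃ s : ℕ → ℕ, StrictMono s ∧
      (∀ w, Tendsto (fun k => inner ℝ (u (s k)) w) atTop (𝓝 (inner ℝ v w))) ∧
      ∀ w, Tendsto (fun k => inner ℝ (laplacian (u (s k))) w) atTop
        (𝓝 (inner ℝ (laplacian v) w)) := by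
  classical
  have : Fact ((2 : ENNReal) ≠ ⊤) := ⟨by norm_num⟩
  obtain ⟨Φ, s, hs, hΦ⟩ := exists_weakly_convergent_subseq (fun k => jet2 (u k)) (C := C)
    (fun k => by rw [norm_jet2]; exact hC k)
  -- The set of jets is closed and convex, hence weakly closed, so the weak limit is the jet of an
  -- element of `S`.
  obtain ⟨v, hv, rfl⟩ := mem_of_weakly_tendsto (hS.isClosed_image_jet2 hΩ)
    (hS.convex_image_jet2 hΩ) (fun k => jet2 (u (s k))) (fun k => ⟨_, hu _, rfl⟩) Φ hΦ
  have hcoord : ∀ o w, Tendsto (fun k => inner ℝ (jet2 (u (s k)) o) w) atTop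
      (𝓝 (inner ℝ (jet2 v o) w)) := by
    intro o w
    simpa only [inner_toLp_single] using hΦ (WithLp.toLp 2 (Pi.single o w))
  refine ⟨v, hv, s, hs, hcoord (Sum.inl none), fun w => ?_⟩
  simp only [laplacian, sum_inner]
  exact tendsto_finsetSum _ fun i _ => hcoord (Sum.inr (i, i)) w

lemma WeaklyTendstoH2.eventually_normH2_le {φ : ℝ → L2 Ω} {φ₀ : L2 Ω}
    (h : WeaklyTendstoH2 φ φ₀) : ∃ C : ℝ, ∀ᶠ δ in 𝓝[>] (0 : ℝ), normH2 (φ δ) ≤ C := by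
  obtain ⟨h0, h1, h2⟩ := h
  have hj : ∀ W : Jet2 Ω, Tendsto (fun δ => inner ℝ (jet2 (φ δ)) W) (𝓝[>] (0 : ℝ))
      (𝓝 (inner ℝ (jet2 φ₀) W)) := by
    intro W
    simp only [PiLp.inner_apply]
    refine tendsto_finsetSum _ fun o _ => ?_
    rcases o with (_ | i) | ⟨i, j⟩
    · exact weaklyTendsto_iff.1 h0 _
    · exact weaklyTendsto_iff.1 (h1 i) _
    · exact weaklyTendsto_iff.1 (h2 i j) _
  obtain ⟨C, hC⟩ := eventually_norm_le_of_weakly_tendsto _ _ hj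
  refine ⟨C, hC.mono fun δ hδ => ?_⟩
  rwa [norm_jet2] at hδ

/-! ### Limits of the penalty terms -/

lemma penaltyLimit_of_tendsto (hΩ : IsOpen Ω) (hb : Bornology.IsBounded Ω) {c : Coeffs n}
    (hc : c.Admissible Ω) (hcoer : c.IsCoercive Ω) (f : L2 Ω) {φ : ℝ → L2 Ω} {φ₀ : L2 Ω}
    (hφ : Tendsto φ (𝓝[>] (0 : ℝ)) (𝓝 φ₀)) {C : ℝ}
    (hC : ∀ᶠ δ in 𝓝[>] (0 : ℝ), ‖penalty c f δ (φ δ)‖ ≤ C) :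
    PenaltyLimit c f φ (T c f φ₀) := by
  have hpos : ∀ᶠ δ in 𝓝[>] (0 : ℝ), 0 < δ := eventually_mem_nhdsWithin
  obtain ⟨-, ξ₀, h1, h2, h3⟩ := tendsto_Tpen hΩ hb hc hcoer f (d := fun δ : ℝ => δ) hpos (tendsto_nhdsWithin_of_tendsto_nhds tendsto_id) hφ hC
  exact ⟨ξ₀, weaklyTendsto_iff.2 h1, h2, h3⟩

/-- Weak convergence gives an `H²` bound for small `δ`, which bounds the penalty terms and, through
Rellich, makes the obstacles converge strongly in `L²`. -/
theorem penaltyLimit_of_weaklyTendstoH2 (hΩ : IsOpen Ω) (hb : Bornology.IsBounded Ω) {c : Coeffs n}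
    (hc : c.Admissible Ω) (hcoer : c.IsCoercive Ω) (f : L2 Ω) {φ : ℝ → L2 Ω} {φ₀ : L2 Ω}
    (hφ₀ : MemU φ₀) (hφ : ∀ δ > 0, MemU (φ δ)) (hw : WeaklyTendstoH2 φ φ₀) :
    (∃ C : ℝ, ∀ᶠ δ in 𝓝[>] (0 : ℝ), ‖penalty c f δ (φ δ)‖ ≤ C) ∧
      PenaltyLimit c f φ (T c f φ₀) := by
  obtain ⟨C, hC0, hC⟩ := exists_norm_penalty_le hΩ hb hc hcoer f
  obtain ⟨M, hM⟩ := hw.eventually_normH2_le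
  have hpos : ∀ᶠ δ in 𝓝[>] (0 : ℝ), 0 < δ := eventually_mem_nhdsWithin
  have hbd : ∀ᶠ δ in 𝓝[>] (0 : ℝ), ‖penalty c f δ (φ δ)‖ ≤ C * (1 + M) := by
    filter_upwards [hpos, hM] with δ h1 h2
    refine (hC δ h1 _ (hφ δ h1)).trans ?_
    gcongr
  refine ⟨⟨_, hbd⟩, penaltyLimit_of_tendsto hΩ hb hc hcoer f ?_ hbd⟩
  exact tendsto_of_weakly_tendsto_of_normH1_le hΩ hb hφ₀.2 (hpos.mono fun δ h => (hφ δ h).2)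
    (hM.mono fun δ h => (normH1_le_normH2 _).trans h) (weaklyTendsto_iff.1 hw.1)

/-! ### Optimal obstacles -/

/-- The minimizers of the adapted penalized problems are bounded in `H²`. -/
lemma exists_normH2_minimizer_le (hΩ : IsOpen Ω) {c : Coeffs n}
    (hc : c.Admissible Ω) (hcoer : c.IsCoercive Ω) (f : L2 Ω) (hK : LaplacianCoerciveOnU Ω)
    (z : L2 Ω) {ν : ℝ} (hν : 0 < ν) {S : Set (L2 Ω)} (hS : IsClosedConvexInU S) {φ₀ : L2 Ω}
    (hφ₀ : φ₀ ∈ S) {φ : ℝ → L2 Ω}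
    (hφ : ∀ δ > 0, φ δ ∈ S ∧ IsMinOn (Jpen c f z ν φ₀ δ) S (φ δ)) :
    ∃ C : ℝ, ∀ δ > 0, normH2 (φ δ) ≤ C := by
  obtain ⟨K, hK⟩ := hK
  obtain ⟨C0, hC0, hC0'⟩ := exists_normH1_Tpen_sub_le hΩ hc hcoer f
  -- `D` bounds the tracking error of the competitor `φ₀` uniformly in `δ`. Comparing costs then
  -- bounds `‖Δφ^δ‖²` by `Q` for every `δ > 0`, not only for small `δ`.
  set D : ℝ := C0 * (1 + normH2 φ₀) + ‖φ₀ - z‖ with hD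
  set Q : ℝ := (D ^ 2 + ν * ‖laplacian φ₀‖ ^ 2) / ν with hQ
  refine ⟨|K| * Real.sqrt Q, fun δ hδ => ?_⟩
  have h1 : Jpen c f z ν φ₀ δ (φ δ) ≤ Jpen c f z ν φ₀ δ φ₀ := (hφ δ hδ).2 hφ₀
  have h2 : ‖Tpen c f δ φ₀ - z‖ ≤ D := by
    have e : Tpen c f δ φ₀ - z = (Tpen c f δ φ₀ - φ₀) + (φ₀ - z) := by abel
    rw [e]
    refine (norm_add_le _ _).trans (add_le_add_left ?_ _)
    exact (norm_le_normH1 _).trans (hC0' δ hδ φ₀ (hS.1 _ hφ₀))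
  have h3 : ‖Tpen c f δ φ₀ - z‖ ^ 2 ≤ D ^ 2 := pow_le_pow_left₀ (norm_nonneg _) h2 2
  rw [Jpen, Jpen, sub_self, norm_zero] at h1
  have h4 : ‖laplacian (φ δ)‖ ≤ Real.sqrt Q := by
    refine Real.le_sqrt_of_sq_le ?_
    rw [hQ, le_div_iff₀ hν]
    nlinarith [sq_nonneg ‖Tpen c f δ (φ δ) - z‖, sq_nonneg ‖φ δ - φ₀‖]
  refine (hK _ (hS.1 _ (hφ δ hδ).1)).trans ?_
  exact (mul_le_mul_of_nonneg_right (le_abs_self K) (norm_nonneg _)).trans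
    (mul_le_mul_of_nonneg_left h4 (abs_nonneg K))

/-- The minimizers of the adapted penalized problems converge in `L²`. -/
lemma tendsto_minimizers (hΩ : IsOpen Ω) (hb : Bornology.IsBounded Ω) {c : Coeffs n}
    (hc : c.Admissible Ω) (hcoer : c.IsCoercive Ω) (f : L2 Ω) (hK : LaplacianCoerciveOnU Ω)
    (z : L2 Ω) {ν : ℝ} (hν : 0 < ν) {S : Set (L2 Ω)} (hS : IsClosedConvexInU S) {φ₀ : L2 Ω}
    (hφ₀ : φ₀ ∈ S) (hmin : IsMinOn (J c f z ν) S φ₀) {φ : ℝ → L2 Ω}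
    (hφ : ∀ δ > 0, φ δ ∈ S ∧ IsMinOn (Jpen c f z ν φ₀ δ) S (φ δ)) :
    Tendsto φ (𝓝[>] (0 : ℝ)) (𝓝 φ₀) := by
  obtain ⟨M, hM⟩ := exists_normH2_minimizer_le hΩ hc hcoer f hK z hν hS hφ₀ hφ
  obtain ⟨C, hC0, hC⟩ := exists_norm_penalty_le hΩ hb hc hcoer f
  refine tendsto_of_subseq_tendsto fun d hd => ?_
  obtain ⟨N, hN⟩ := eventually_atTop.1 (hd.eventually (eventually_mem_nhdsWithin))
  have hpos : ∀ k, 0 < d (k + N) := fun k => hN _ (by omega)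
  obtain ⟨v, hv, s, hs, hsv, hsΔ⟩ := hS.exists_subseq hΩ (u := fun k => φ (d (k + N)))
    (fun k => (hφ _ (hpos k)).1) (fun k => hM _ (hpos k))
  set e : ℕ → ℝ := fun k => d (s k + N) with he
  have hepos : ∀ k, 0 < e k := fun k => hpos _
  have he0 : Tendsto e atTop (𝓝 0) := (tendsto_nhds_of_tendsto_nhdsWithin hd).comp
    ((tendsto_add_atTop_nat N).comp hs.tendsto_atTop)
  have hlim : Tendsto (fun k => φ (e k)) atTop (𝓝 v) :=
    tendsto_of_weakly_tendsto_of_normH1_le hΩ hb (hS.1 _ hv).2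
      (Eventually.of_forall fun k => (hS.1 _ (hφ _ (hepos k)).1).2)
      (Eventually.of_forall fun k => (normH1_le_normH2 _).trans (hM _ (hepos k))) hsv
  have hT := (tendsto_Tpen hΩ hb hc hcoer f (Eventually.of_forall hepos) he0 hlim
    (C := C * (1 + M)) (Eventually.of_forall fun k =>
      (hC _ (hepos k) _ (hS.1 _ (hφ _ (hepos k)).1)).trans
        (by have := hM _ (hepos k); gcongr))).1
  have hT₀ := (tendsto_Tpen hΩ hb hc hcoer f (Eventually.of_forall hepos) he0
    (tendsto_const_nhds (x := φ₀)) (C := C * (1 + normH2 φ₀)) (Eventually.of_forall fun k =>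
      hC _ (hepos k) _ (hS.1 _ hφ₀))).1
  -- Weak lower semicontinuity by linearization: `‖Δφ‖²` is replaced by the minorant `2(Δφ, Δv) -
  -- ‖Δv‖²`, which converges to `‖Δv‖²` under weak convergence.
  have hkey : ∀ k, 1 / 2 * (‖Tpen c f (e k) (φ (e k)) - z‖ ^ 2 +
      ν * (2 * inner ℝ (laplacian (φ (e k))) (laplacian v) - ‖laplacian v‖ ^ 2) +
      ‖φ (e k) - φ₀‖ ^ 2) ≤
      1 / 2 * (‖Tpen c f (e k) φ₀ - z‖ ^ 2 + ν * ‖laplacian φ₀‖ ^ 2) := by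
    intro k
    have h1 : Jpen c f z ν φ₀ (e k) (φ (e k)) ≤ Jpen c f z ν φ₀ (e k) φ₀ :=
      (hφ _ (hepos k)).2 hφ₀
    rw [Jpen, Jpen, sub_self, norm_zero] at h1
    have h2 : 0 ≤ ‖laplacian (φ (e k)) - laplacian v‖ ^ 2 := by positivity
    rw [norm_sub_sq_real] at h2
    have h3 := mul_nonneg hν.le h2
    linarith
  have hfin := le_of_tendsto_of_tendsto'
    ((((hT.sub_const z).norm.pow 2).add ((((hsΔ (laplacian v)).const_mul 2).sub_const
      (‖laplacian v‖ ^ 2)).const_mul ν)).add ((hlim.sub_const φ₀).norm.pow 2) |>.const_mul (1 / 2))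
    ((((hT₀.sub_const z).norm.pow 2).add_const (ν * ‖laplacian φ₀‖ ^ 2)).const_mul (1 / 2)) hkey
  have hJ : J c f z ν φ₀ ≤ J c f z ν v := hmin hv
  rw [J, J] at hJ
  rw [real_inner_self_eq_norm_sq] at hfin
  -- The adapted term `‖φ - φ₀‖²` identifies the limit: minimality of `φ₀` for `J` cancels
  -- everything else.
  have h0 : ‖v - φ₀‖ ^ 2 ≤ 0 := by linarith
  have h1 : v = φ₀ := by
    have h2 : ‖v - φ₀‖ = 0 := by
      have := sq_nonneg ‖v - φ₀‖
      exact pow_eq_zero_iff (two_ne_zero) |>.1 (le_antisymm h0 this)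
    exact sub_eq_zero.1 (norm_eq_zero.1 h2)
  exact ⟨fun k => s k + N, h1 ▸ hlim⟩

end ObstacleControl

end

theorem mainTheorem8 (n : ℕ) (hn : 1 ≤ n) (hn3 : n ≤ 3)
    (Ω : Set (ObstacleControl.E n)) (hΩo : IsOpen Ω) (hΩb : Bornology.IsBounded Ω)
    (hΩl : ObstacleControl.HasLipschitzBoundary Ω)
    (c : ObstacleControl.Coeffs n) (hc : c.Admissible Ω) (hcoer : c.IsCoercive Ω)
    (f : ObstacleControl.L2 Ω) :
    -- the `L²` bound on the penalty term in terms of the `H²` norm of the obstacle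
    (∃ C : ℝ, ∀ δ > 0, ∀ φ : ObstacleControl.L2 Ω, ObstacleControl.MemU φ →
      ‖ObstacleControl.penalty c f δ φ‖ ≤ C * (1 + ObstacleControl.normH2 φ)) ∧
    -- obstacles converging weakly in `H²`
    (∀ (φstar : ObstacleControl.L2 Ω) (φ : ℝ → ObstacleControl.L2 Ω),
      ObstacleControl.MemU φstar → (∀ δ > 0, ObstacleControl.MemU (φ δ)) →
      ObstacleControl.WeaklyTendstoH2 φ φstar →
      (∃ C : ℝ, ∀ᶠ δ in 𝓝[>] (0 : ℝ), ‖ObstacleControl.penalty c f δ (φ δ)‖ ≤ C) ∧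
      ObstacleControl.PenaltyLimit c f φ (ObstacleControl.T c f φstar)) ∧
    -- optimal obstacles
    (ObstacleControl.LaplacianCoerciveOnU Ω →
      ∀ (z : ObstacleControl.L2 Ω) (ν : ℝ), 0 < ν →
      ∀ Uad : Set (ObstacleControl.L2 Ω), ObstacleControl.IsClosedConvexInU Uad →
      ∀ φstar ∈ Uad, IsMinOn (ObstacleControl.J c f z ν) Uad φstar →
      ∀ φ : ℝ → ObstacleControl.L2 Ω,
      (∀ δ > 0, φ δ ∈ Uad ∧ IsMinOn (ObstacleControl.Jpen c f z ν φstar δ) Uad (φ δ)) →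
      (∃ C : ℝ, ∀ δ > 0, ‖ObstacleControl.penalty c f δ (φ δ)‖ ≤ C) ∧
      ObstacleControl.PenaltyLimit c f φ (ObstacleControl.T c f φstar)) := by
  obtain ⟨C, hC0, hC⟩ := ObstacleControl.exists_norm_penalty_le hΩo hΩb hc hcoer f
  refine ⟨⟨C, hC⟩, fun φstar φ hφstar hφ hw =>
    ObstacleControl.penaltyLimit_of_weaklyTendstoH2 hΩo hΩb hc hcoer f hφstar hφ hw, ?_⟩
  intro hK z ν hν Uad hUad φstar hφstar hmin φ hφ
  obtain ⟨M, hM⟩ := ObstacleControl.exists_normH2_minimizer_le hΩo hc hcoer f hK z hν hUad hφstar hφ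
  have hbd : ∀ δ > 0, ‖ObstacleControl.penalty c f δ (φ δ)‖ ≤ C * (1 + M) := by
    intro δ hδ
    refine (hC δ hδ _ (hUad.1 _ (hφ δ hδ).1)).trans ?_
    have := hM δ hδ
    gcongr
  refine ⟨⟨_, hbd⟩, ObstacleControl.penaltyLimit_of_tendsto hΩo hΩb hc hcoer f
    (ObstacleControl.tendsto_minimizers hΩo hΩb hc hcoer f hK z hν hUad hφstar hmin hφ)
    (C := C * (1 + M)) ?_⟩
  exact eventually_mem_nhdsWithin.mono hbd
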